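/- Let $A_1,\dots,A_d$ be Hermitian $n\times n$ matrices, linearly independent over $\mathbb R$, and suppose that the model quadric $$M_H=\{(z,w)\in\mathbb C^n\times\mathbb C^d:\ \Re e\, w_j={}^t\bar z A_j z,\ j=1,\dots,d\}$$ is strongly pseudoconvex, i.e. some real linear combination of the $A_j$ is positive definite. Fix any $b\in\mathbb R^d$ such that $B:=\sum_j b_jA_j$ is positive definite. For $a\in\mathbb C^d$ put $P=\sum_j a_jA_j$ and $A=\sum_j(b_j-a_j-\overline{a_j})A_j$. A *stationary lift* is a map $\boldsymbol f=(f,\tilde f)$, continuous on the closed unit disc and holomorphic inside, such that $f$ is nonconstant, $f(\partial\Delta)\subset M_H$, and there are real functions $c_1,\dots,c_d$ on $\partial\Delta$ with $\sum_j c_j(\zeta)\partial r_j(0)\ne0$ and $\tilde f(\zeta)=\zeta\sum_j c_j(\zeta)\,\partial r_j(f(\zeta))$ for $|\zeta|=1$, where $r_j=\Re e\,w_j-{}^t\bar zA_jz$. Let $\mathcal S_0(M_H)$ be the set of stationary lifts with $\boldsymbol f(1)=(0,0,0,b/2)$. (1) There is $\rho>0$ such that for every $a\in\mathbb C^d$ with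 $\|a\|<\rho$ the equation $PX^2+AX+{}^t\overline P=0$ has exactly one solution $X=X(a)$ with operator norm $\|X\|<1$. Put $K_j=\sum_{r\ge0}({}^t\overline X)^rA_jX^r$, and for $V\in\mathbb C^n$ put $q_j(a,V)={}^t\overline V(I-{}^t\overline X)K_j(I-X)V\in\mathbb R$. For $\|a\|<\rho$ and $V\neq0$, writing $U=(I-X)V$, there is a lift $\boldsymbol f=(h,g,\tilde h,\tilde g)\in\mathcal S_0(M_H)$ given by $$h(\zeta)=U-\zeta(I-\zeta X)^{-1}(I-X)U,$$ $$\begin{aligned}g_j(\zeta)={}&{}^t\overline UA_jU-2\,{}^t\overline UA_j\,\zeta(I-\zeta X)^{-1}(I-X)U+{}^t\overline U({}^t\overline XK_j-K_jX)U\\&+{}^t\overline U(I-{}^t\overline X)K_j\bigl(I+2\zeta X(I-\zeta X)^{-1}\bigr)(I-X)U,\end{aligned}$$ $$\tilde h(\zeta)=-\zeta\,{}^t\overline{h(\zeta)}\sum_{j}\bigl(a_j\overline\zeta+(b_j-a_j-\overline{a_j})+\overline{a_j}\zeta\bigr)A_j\quad(|\zeta|=1),$$ $$\tilde g(\zeta)=\tfrac12\bigl(a+(b-a-\overline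 a)\zeta+\overline a\zeta^2\bigr),$$ and its derivative at $\zeta=1$ (within the closed disc) is $$\boldsymbol f'(1)=\bigl(-V,\ (-2q_j(a,V))_{j},\ -{}^t\overline V B,\ \tfrac b2-i\,\Im m\,a\bigr).$$ Hence, after linear changes of variables and dropping the component $-{}^t\overline VB$ (determined by $V$), the $1$-jet map at $\zeta=1$ on this family is $$\mathfrak j_1:\mathbb C^d\times\mathbb C^n\to\mathbb C^n\times\mathbb R^d\times\mathbb R^d,\qquad \mathfrak j_1(a,V)=\bigl(V,\ (q_j(a,V))_{j},\ \Im m\,a\bigr).$$ (2) For every $\varepsilon>0$ there exist $a\in\mathbb R^d$ with $\|a\|<\varepsilon$ and $V\in\mathbb C^n$ such that $\mathfrak j_1$ is a local ($C^\infty$, real) diffeomorphism at $(a,V)$. -/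

import Mathlib

open scoped Matrix Manifold ContDiff ComplexConjugate ComplexOrder Matrix.Norms.L2Operator

noncomputable section

namespace StationaryJet

variable {n d : ℕ}

/-- The linear combination `∑ j, c j • A j` of the given matrices. -/
def pencil (A : Fin d → Matrix (Fin n) (Fin n) ℂ) (c : Fin d → ℂ) : Matrix (Fin n) (Fin n) ℂ :=
  ∑ j, c j • A j

/-- Strong pseudoconvexity: some real linear combination of the `A j` is positive definite. -/
def StronglyPseudoconvex (A : Fin d → Matrix (Fin n) (Fin n) ℂ) : Prop :=
  ∃ b : Fin d → ℝ, (pencil A (fun j => (b j : ℂ))).PosDef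

/-- The model quadric `Re w_j = ᵗz̄ A_j z`, `j = 1, …, d`, in `ℂⁿ × ℂᵈ`. -/
def quadric (A : Fin d → Matrix (Fin n) (Fin n) ℂ) : Set ((Fin n → ℂ) × (Fin d → ℂ)) :=
  {p | ∀ j, ((p.2 j).re : ℂ) = star p.1 ⬝ᵥ (A j *ᵥ p.1)}

/-- The (1,0)-differential at `p = (z, w)` of the defining function `r_j = Re w_j - ᵗz̄ A_j z`:
its `dz`-part is the row vector `-ᵗz̄ A_j` and its `dw`-part is `½ e_j`. -/
def delDefining (A : Fin d → Matrix (Fin n) (Fin n) ℂ) (j : Fin d)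
    (p : (Fin n → ℂ) × (Fin d → ℂ)) : (Fin n → ℂ) × (Fin d → ℂ) :=
  (-(star p.1 ᵥ* A j), Pi.single j (1 / 2 : ℂ))

/-- `F = (f, f̃)` is a holomorphic lift of the nonconstant stationary disc `f` attached to the
quadric. Only the values of `F` on the closed unit disc matter. -/
structure IsStationaryLift (A : Fin d → Matrix (Fin n) (Fin n) ℂ)
    (F : ℂ → ((Fin n → ℂ) × (Fin d → ℂ)) × ((Fin n → ℂ) × (Fin d → ℂ))) : Prop where
  holo : DiffContOnCl ℂ F (Metric.ball 0 1)
  attached : ∀ ζ ∈ Metric.sphere (0 : ℂ) 1, (F ζ).1 ∈ quadric A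
  conormal : ∃ c : ℂ → Fin d → ℝ, ∀ ζ ∈ Metric.sphere (0 : ℂ) 1,
    (∑ j, (c ζ j : ℂ) • delDefining A j 0) ≠ 0 ∧
      (F ζ).2 = ζ • ∑ j, (c ζ j : ℂ) • delDefining A j (F ζ).1
  nonconstant : ∃ ζ ∈ Metric.closedBall (0 : ℂ) 1, ∃ ζ' ∈ Metric.closedBall (0 : ℂ) 1,
    (F ζ).1 ≠ (F ζ').1

/-- The set of lifts of stationary discs with value `(0, 0, 0, b/2)` at `ζ = 1`. -/
def pointedLifts (A : Fin d → Matrix (Fin n) (Fin n) ℂ) (b : Fin d → ℝ) :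
    Set (ℂ → ((Fin n → ℂ) × (Fin d → ℂ)) × ((Fin n → ℂ) × (Fin d → ℂ))) :=
  {F | IsStationaryLift A F ∧ F 1 = ((0, 0), (0, fun j => (b j : ℂ) / 2))}

/-- The middle coefficients `b_j - a_j - ā_j`. -/
def middle (b : Fin d → ℝ) (a : Fin d → ℂ) : Fin d → ℂ :=
  fun j => (b j : ℂ) - a j - conj (a j)

/-- `X` solves `P X² + A X + ᵗP̄ = 0` with `P = ∑ a_j A_j` and `A = ∑ (b_j - a_j - ā_j) A_j`, and
`‖X‖ < 1` in the operator norm. -/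
def IsSmallSolution (A : Fin d → Matrix (Fin n) (Fin n) ℂ) (b : Fin d → ℝ) (a : Fin d → ℂ)
    (X : Matrix (Fin n) (Fin n) ℂ) : Prop :=
  pencil A a * X ^ 2 + pencil A (middle b a) * X + (pencil A a)ᴴ = 0 ∧ ‖X‖ < 1

/-- The solution `X = X(a, b)` of the quadratic matrix equation with `‖X‖ < 1`
(meaningful where it exists and is unique). -/
def smallSolution (A : Fin d → Matrix (Fin n) (Fin n) ℂ) (b : Fin d → ℝ) (a : Fin d → ℂ) :
    Matrix (Fin n) (Fin n) ℂ :=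
  Classical.epsilon (IsSmallSolution A b a)

/-- `K_j = ∑_{r ≥ 0} (ᵗX̄)^r A_j X^r`. -/
def Kmat (A : Fin d → Matrix (Fin n) (Fin n) ℂ) (X : Matrix (Fin n) (Fin n) ℂ) (j : Fin d) :
    Matrix (Fin n) (Fin n) ℂ :=
  ∑' r : ℕ, Xᴴ ^ r * A j * X ^ r

/-- The disc lift `F = (h, g, h̃, g̃)` is given by the explicit formulas with parameters `(a, V)`.
The formula for `h̃` involves `ᵗh̄` and holds on the unit circle. -/
structure HasExplicitForm (A : Fin d → Matrix (Fin n) (Fin n) ℂ) (b : Fin d → ℝ)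
    (a : Fin d → ℂ) (V : Fin n → ℂ)
    (F : ℂ → ((Fin n → ℂ) × (Fin d → ℂ)) × ((Fin n → ℂ) × (Fin d → ℂ))) : Prop where
  h_eq : ∀ ζ ∈ Metric.closedBall (0 : ℂ) 1,
    let X := smallSolution A b a
    (F ζ).1.1 = V - ζ • (((1 - ζ • X)⁻¹ * (1 - X)) *ᵥ V)
  g_eq : ∀ ζ ∈ Metric.closedBall (0 : ℂ) 1, ∀ j,
    let X := smallSolution A b a
    let K := Kmat A X j
    (F ζ).1.2 j = star V ⬝ᵥ (A j *ᵥ V)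
      - 2 * (star V ⬝ᵥ ((A j * (ζ • ((1 - ζ • X)⁻¹ * (1 - X)))) *ᵥ V))
      + star V ⬝ᵥ ((Xᴴ * K - K * X) *ᵥ V)
      + star V ⬝ᵥ (((1 - Xᴴ) * K * (1 + (2 * ζ) • (X * (1 - ζ • X)⁻¹)) * (1 - X)) *ᵥ V)
  hTilde_eq : ∀ ζ ∈ Metric.sphere (0 : ℂ) 1,
    (F ζ).2.1 = -(ζ • (star (F ζ).1.1 ᵥ*
      pencil A (fun j => a j * conj ζ + middle b a j + conj (a j) * ζ)))
  gTilde_eq : ∀ ζ ∈ Metric.closedBall (0 : ℂ) 1, ∀ j,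
    (F ζ).2.2 j = (a j + middle b a j * ζ + conj (a j) * ζ ^ 2) / 2

/-- The Hermitian forms `ᵗV̄ (I - ᵗX̄) K_j (I - X) V`, `X = X(a, b)`; they are real valued. -/
def jetForm (A : Fin d → Matrix (Fin n) (Fin n) ℂ) (b : Fin d → ℝ)
    (a : Fin d → ℂ) (V : Fin n → ℂ) (j : Fin d) : ℝ :=
  let X := smallSolution A b a
  (star V ⬝ᵥ (((1 - Xᴴ) * Kmat A X j * (1 - X)) *ᵥ V)).re

/-- The `1`-jet map at `ζ = 1`:
`(a, V) ↦ (V, (ᵗV̄ (I - ᵗX̄) K_j (I - X) V)_j, Im a)`. -/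
def oneJetMap (A : Fin d → Matrix (Fin n) (Fin n) ℂ) (b : Fin d → ℝ) :
    (Fin d → ℂ) × (Fin n → ℂ) → (Fin n → ℂ) × (Fin d → ℝ) × (Fin d → ℝ) :=
  fun p => (p.2, jetForm A b p.1 p.2, fun j => (p.1 j).im)

end StationaryJet

end

/-!
Write `P = ∑ a_j A_j`, `B = ∑ b_j A_j`, and let `X` be the small solution of the quadratic equation
`P X² + (B - P - P*) X + P* = 0`.

**The lifts.** For small `a` the solution `X` is unique because `B` dominates the other
coefficients, and it exists and is analytic in `a` by the implicit function theorem
(`smallSolution_spec`). The explicit map is a stationary lift because of two identities on the unit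
circle. The quadratic equation makes `1 - ζ̄ X*` a left factor of `ζ̄ P + (B - P - P*) + ζ P*`, which
cancels the resolvent in the conjugate of `h` and leaves a polynomial `h̃` (`hTildeForm_eq`). The
Stein equation `K_j = A_j + X* K_j X` splits `(1 - ζ X)⁻* A_j (1 - ζ X)⁻¹` into a holomorphic part
and its adjoint, which gives `Re g_j = h* A_j h` (`gForm_add_conjTranspose`).

**The jet map.** Since `V` and `Im a` are components of the `1`-jet map, its derivative at
`(a, V)` is injective as soon as the derivative of `a ↦ (q_j(a, V))_j` in real directions is. At a
real point `a` put `M = B⁻¹ P` and, for a real direction `t`, `N = B⁻¹ ∑ t_j A_j`. The equation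
becomes `M = -X (1 - X)⁻²`, so that `Y = (1 + X) (1 - X)⁻¹` is a square root of `1 - 4 M`, and
everything is self-adjoint for the scalar product of `B`. One finds `∑ t_j q_j = V* B L V` where
`Y L + L Y = 2 N`; thus `L` is `-1/2` times the derivative of `Y` in the direction `t`, and `q` is
the gradient in `a` of `-1/2 · V* B Y V`. The derivative of `q` is the Hessian of this function,
which is positive semidefinite, as the square root is operator concave: differentiating once more,
`Y L' + L' Y = 4 L²`, whence `∑ t_j q_j' = 2 ∑_r ‖L X ^ r (1 - X) V‖²` in the norm of `B`. If this
vanishes, then `N M ^ m V = 0` for all `m` (`relPencil_mul_pow_mulVec_eq_zero`).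

It remains to find `a` and `V` for which this forces `t = 0` (`exists_krylov_separating`). Choose
them so that the Krylov space `W = span {V, M V, M² V, …}` has the largest possible dimension `r`.
If `N` vanishes on `W`, then for `c ≠ 0` the pair `(c M + N, V)` has the same Krylov space, and
maximality shows, on perturbing `V`, that a suitable monic polynomial of degree `r` in `c M + N` has
its range in `W`. Letting `c → 0` gives `N ^ r w ∈ W` for all `w`, hence `N ^ (r + 1) = 0`. But `N`
is self-adjoint for the scalar product of `B`, so `N = 0`, and `t = 0` by linear independence. The
condition is invariant under scaling of `a`, so `a` may be taken as small as desired.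
-/


noncomputable section

namespace StationaryJet

open Filter Topology

variable {n d : ℕ}

/-! ### The inverse function theorem -/

/-- The inverse function theorem in the language of `IsLocalDiffeomorphAt`. -/
theorem isLocalDiffeomorphAt_of_contDiffAt {E F : Type*} [NormedAddCommGroup E] [NormedSpace ℝ E]
    [CompleteSpace E] [NormedAddCommGroup F] [NormedSpace ℝ F] {f : E → F} {x : E}
    (hf : ContDiffAt ℝ ω f x) (e : E ≃L[ℝ] F) (he : HasFDerivAt f (e : E →L[ℝ] F) x) :
    IsLocalDiffeomorphAt 𝓘(ℝ, E) 𝓘(ℝ, F) ∞ f x := by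
  -- Near `x` the map is analytic and its derivative is invertible.
  have hev : ∀ᶠ y in 𝓝 x, ContDiffAt ℝ ω f y ∧
      fderiv ℝ f y ∈ Set.range ((↑) : (E ≃L[ℝ] F) → E →L[ℝ] F) := by
    refine (hf.eventually (by simp)).and ?_
    have hc : ContinuousAt (fderiv ℝ f) x :=
      (hf.fderiv_right (m := 0) (by simp)).continuousAt
    refine hc.eventually (ContinuousLinearEquiv.isOpen.mem_nhds ⟨e, ?_⟩)
    rw [he.fderiv]
  obtain ⟨u, hu, huo, hxu⟩ := eventually_nhds_iff.1 hev
  set Φ := (hf.toOpenPartialHomeomorph f he (by simp)).restrOpen u huo with hΦ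
  have hsrc : ∀ y ∈ Φ.source, y ∈ u := fun y hy => hy.2
  refine ⟨⟨Φ.toPartialEquiv, Φ.open_source, Φ.open_target, ?_, ?_⟩,
    ⟨hf.mem_toOpenPartialHomeomorph_source he (by simp), hxu⟩, fun y hy => rfl⟩
  · refine contMDiffOn_iff_contDiffOn.2 fun y hy => ?_
    exact ((hu y (hsrc y hy)).1.of_le (by simp)).contDiffWithinAt
  · refine contMDiffOn_iff_contDiffOn.2 fun y hy => ?_
    have hy' : Φ.symm y ∈ Φ.source := Φ.map_target hy
    obtain ⟨h1, e', h2⟩ := hu _ (hsrc _ hy')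
    refine ((Φ.contDiffAt_symm (n := ω) hy (f₀' := e') ?_ h1).of_le (by simp)).contDiffWithinAt
    rw [h2]
    exact (h1.differentiableAt (by simp)).hasFDerivAt

/-- Between spaces of the same finite dimension, injectivity of the derivative suffices. -/
theorem isLocalDiffeomorphAt_of_injective_fderiv {E F : Type*} [NormedAddCommGroup E]
    [NormedSpace ℝ E] [FiniteDimensional ℝ E] [NormedAddCommGroup F] [NormedSpace ℝ F]
    [FiniteDimensional ℝ F] (hEF : Module.finrank ℝ E = Module.finrank ℝ F) {f : E → F} {x : E}
    (hf : ContDiffAt ℝ ω f x) (hinj : ∀ v, fderiv ℝ f x v = 0 → v = 0) :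
    IsLocalDiffeomorphAt 𝓘(ℝ, E) 𝓘(ℝ, F) ∞ f x := by
  have : CompleteSpace E := FiniteDimensional.complete ℝ E
  have hi : Function.Injective (fderiv ℝ f x : E →ₗ[ℝ] F) :=
    (injective_iff_map_eq_zero _).2 hinj
  let e := (LinearEquiv.ofInjectiveOfFinrankEq _ hi hEF).toContinuousLinearEquiv
  refine isLocalDiffeomorphAt_of_contDiffAt hf e ?_
  have : (e : E →L[ℝ] F) = fderiv ℝ f x := by ext; rfl
  rw [this]
  exact (hf.differentiableAt (by simp)).hasFDerivAt

/-! ### Krylov spaces in real-linear families of matrices -/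

/-- The vectors `v, Q v, …, Q ^ (r - 1) v`. -/
def krylov (r : ℕ) (Q : Matrix (Fin n) (Fin n) ℂ) (v : Fin n → ℂ) : Fin r → Fin n → ℂ :=
  fun m => Q ^ (m : ℕ) *ᵥ v

theorem krylov_succ (r : ℕ) (Q : Matrix (Fin n) (Fin n) ℂ) (v : Fin n → ℂ) :
    krylov (r + 1) Q v = Fin.snoc (krylov r Q v) (Q ^ r *ᵥ v) := by
  ext m : 1
  refine Fin.lastCases ?_ (fun i => ?_) m
  · simp [krylov]
  · simp [krylov]

/-- If no Krylov space `span {v, Q v, …}` has dimension exceeding `r`, and `v` attains this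
dimension for `Q`, then a monic polynomial of degree `r` in `Q` that kills `v` maps everything
into the Krylov space of `v`: otherwise perturbing `v` would increase the dimension. -/
theorem monic_mulVec_mem_span_krylov {r : ℕ} {Q : Matrix (Fin n) (Fin n) ℂ} {v : Fin n → ℂ}
    (hmax : ∀ w, ¬ LinearIndependent ℂ (krylov (r + 1) Q w))
    (hv : LinearIndependent ℂ (krylov r Q v)) {β : Fin r → ℂ}
    (hβ : Q ^ r *ᵥ v = ∑ m, β m • krylov r Q v m) (w : Fin n → ℂ) :
    Q ^ r *ᵥ w - ∑ m, β m • krylov r Q w m ∈ Submodule.span ℂ (Set.range (krylov r Q v)) := by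
  by_contra hu
  set u := Q ^ r *ᵥ w - ∑ m, β m • krylov r Q w m with hu_def
  have h0 : LinearIndependent ℂ
      (Fin.snoc (krylov r Q v) u : Fin (r + 1) → Fin n → ℂ) :=
    linearIndependent_finSnoc.2 ⟨hv, hu⟩
  let g : ℂ → Fin (r + 1) → Fin n → ℂ := fun s => Fin.snoc (krylov r Q (v + s • w)) u
  have hg : ContinuousAt g 0 := by
    refine continuousAt_pi.2 fun m => ?_
    refine Fin.lastCases ?_ (fun i => ?_) m
    · simp only [g, Fin.snoc_last]; exact continuousAt_const
    · simp only [g, Fin.snoc_castSucc, krylov]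
      exact (Continuous.matrix_mulVec continuous_const (by fun_prop)).continuousAt
  have hev : ∀ᶠ s in 𝓝 (0 : ℂ), LinearIndependent ℂ (g s) :=
    hg.eventually (LinearIndependent.eventually (by simpa [g] using h0))
  obtain ⟨s, hs, hs0⟩ := ((hev.filter_mono nhdsWithin_le_nhds).and
    (self_mem_nhdsWithin : {(0 : ℂ)}ᶜ ∈ 𝓝[≠] 0)).exists
  obtain ⟨h1, h2⟩ := linearIndependent_finSnoc.1 hs
  refine hmax (v + s • w) ?_
  rw [krylov_succ]
  refine linearIndependent_finSnoc.2 ⟨h1, fun h3 => h2 ?_⟩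
  have h4 : s • u = Q ^ r *ᵥ (v + s • w) - ∑ m, β m • krylov r Q (v + s • w) m := by
    simp only [hu_def, krylov, Matrix.mulVec_add, Matrix.mulVec_smul, smul_add,
      Finset.sum_add_distrib, smul_sub, Finset.smul_sum] at hβ ⊢
    rw [hβ]
    simp only [smul_comm s]
    abel
  have h5 : s • u ∈ Submodule.span ℂ (Set.range (krylov r Q (v + s • w))) := by
    rw [h4]
    exact Submodule.sub_mem _ h3 (Submodule.sum_mem _ fun m _ =>
      Submodule.smul_mem _ _ (Submodule.subset_span ⟨m, rfl⟩))
  exact (Submodule.smul_mem_iff _ hs0).1 h5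

/-- In a real-linear family of matrices whose only nilpotent member is zero, some member `N a` and
some vector `V` are such that no nonzero member vanishes on the whole Krylov space of `N a` and
`V`. A pair with a Krylov space of the largest possible dimension has this property. -/
theorem exists_krylov_separating {E : Type*} [AddCommGroup E] [Module ℝ E]
    (N : E →ₗ[ℝ] Matrix (Fin n) (Fin n) ℂ) (hN : ∀ t k, N t ^ k = 0 → t = 0) :
    ∃ (a : E) (V : Fin n → ℂ), ∀ t, (∀ m : ℕ, (N t * N a ^ m) *ᵥ V = 0) → t = 0 := by
  classical
  let p : ℕ → Prop := fun r => ∃ (a : E) (V : Fin n → ℂ), LinearIndependent ℂ (krylov r (N a) V)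
  have hp0 : p 0 := ⟨0, 0, linearIndependent_empty_type⟩
  have hpb : ∀ r, p r → r ≤ n := by
    rintro r ⟨a, V, h⟩
    simpa using h.fintype_card_le_finrank
  obtain ⟨hr, hmax⟩ : p (Nat.findGreatest p n) ∧ ¬ p (Nat.findGreatest p n + 1) := by
    refine ⟨Nat.findGreatest_spec (Nat.zero_le _) hp0, fun h => ?_⟩
    have := Nat.le_findGreatest (hpb _ h) h
    omega
  set r := Nat.findGreatest p n
  obtain ⟨a, V, hV⟩ := hr
  refine ⟨a, V, fun t ht => ?_⟩
  have hmax' : ∀ a' w, ¬ LinearIndependent ℂ (krylov (r + 1) (N a') w) :=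
    fun a' w h => hmax ⟨a', w, h⟩
  obtain ⟨β, hβ⟩ : ∃ β : Fin r → ℂ, N a ^ r *ᵥ V = ∑ m, β m • krylov r (N a) V m := by
    have : N a ^ r *ᵥ V ∈ Submodule.span ℂ (Set.range (krylov r (N a) V)) := by
      by_contra h
      exact hmax' a V (by rw [krylov_succ]; exact linearIndependent_finSnoc.2 ⟨hV, h⟩)
    obtain ⟨β, hβ⟩ := (Submodule.mem_span_range_iff_exists_fun ℂ).1 this
    exact ⟨β, hβ.symm⟩
  set W := Submodule.span ℂ (Set.range (krylov r (N a) V)) with hW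
  have hQ : ∀ (c : ℝ) (m : ℕ), N (c • a + t) ^ m *ᵥ V = (c : ℂ) ^ m • (N a ^ m *ᵥ V) := by
    intro c m
    induction m with
    | zero => simp
    | succ m ih =>
      have h1 := ht m
      rw [← Matrix.mulVec_mulVec] at h1
      have h2 : N (c • a) = (c : ℂ) • N a := by rw [map_smul]; ext; simp
      rw [pow_succ', ← Matrix.mulVec_mulVec, ih, Matrix.mulVec_smul, map_add, Matrix.add_mulVec, h1,
        h2, Matrix.smul_mulVec, Matrix.mulVec_mulVec, ← pow_succ', add_zero, smul_smul, ← pow_succ]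
  have hkey : ∀ w : Fin n → ℂ, N t ^ r *ᵥ w ∈ W := by
    intro w
    -- The relation below holds for `c ≠ 0`; its limit for `c → 0` is the claim.
    let F : ℝ → Fin n → ℂ := fun c => N (c • a + t) ^ r *ᵥ w -
      ∑ m : Fin r, ((c : ℂ) ^ (r - (m : ℕ)) * β m) • (N (c • a + t) ^ (m : ℕ) *ᵥ w)
    have hF : Continuous F := by
      have hc : Continuous fun c : ℝ => N (c • a + t) := by
        simp only [map_add, map_smul]; fun_prop
      have hp : ∀ m : ℕ, Continuous fun c : ℝ => N (c • a + t) ^ m *ᵥ w := fun m =>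
        Continuous.matrix_mulVec (hc.pow m) continuous_const
      refine (hp r).sub (continuous_finsetSum _ fun m _ => ?_)
      have h1 : Continuous fun c : ℝ => (c : ℂ) ^ (r - (m : ℕ)) * β m := by fun_prop
      exact h1.smul (hp m)
    have hF0 : F 0 = N t ^ r *ᵥ w := by
      simp only [F, zero_smul, zero_add, Complex.ofReal_zero]
      rw [Finset.sum_eq_zero, sub_zero]
      intro m _
      rw [zero_pow (by omega), zero_mul, zero_smul]
    have hFW : ∀ c : ℝ, c ≠ 0 → F c ∈ W := by
      intro c hc
      have hc' : (c : ℂ) ≠ 0 := by exact_mod_cast hc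
      have hkr : krylov r (N (c • a + t)) V =
          (fun m : Fin r => (Units.mk0 _ hc') ^ (m : ℕ)) • krylov r (N a) V := by
        ext m : 1
        simp only [krylov, hQ, Pi.smul_apply', Units.smul_def]
        simp
      have hli : LinearIndependent ℂ (krylov r (N (c • a + t)) V) := by
        rw [hkr]; exact hV.units_smul _
      have := monic_mulVec_mem_span_krylov (β := fun m => (c : ℂ) ^ (r - (m : ℕ)) * β m)
        (hmax' (c • a + t)) hli ?_ w
      · refine Submodule.span_le.2 ?_ this
        rintro _ ⟨m, rfl⟩
        rw [hkr]
        exact Submodule.smul_mem _ _ (Submodule.subset_span ⟨m, rfl⟩)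
      · rw [hQ, hβ, Finset.smul_sum]
        refine Finset.sum_congr rfl fun m _ => ?_
        simp only [krylov, hQ, smul_smul]
        rw [mul_right_comm, ← pow_add, Nat.sub_add_cancel m.2.le]
    have hcl : IsClosed (W : Set (Fin n → ℂ)) := W.closed_of_finiteDimensional
    rw [← hF0]
    refine hcl.mem_of_tendsto (b := 𝓝[≠] (0 : ℝ)) (hF.continuousAt.tendsto.mono_left
      nhdsWithin_le_nhds) ?_
    exact eventually_nhdsWithin_of_forall fun c hc => hFW c hc
  have hker : ∀ w ∈ W, N t *ᵥ w = 0 := by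
    intro w hw
    have : W ≤ LinearMap.ker (Matrix.mulVecLin (N t)) := by
      refine Submodule.span_le.2 ?_
      rintro _ ⟨m, rfl⟩
      simpa [krylov] using ht m
    simpa using this hw
  refine hN t (r + 1) (Matrix.ext_of_mulVec_single fun i => ?_)
  rw [pow_succ', ← Matrix.mulVec_mulVec, hker _ (hkey _), Matrix.zero_mulVec]

/-- A positive definite form has no nonzero isotropic vectors. -/
theorem eq_zero_of_dotProduct_mulVec_eq_zero {B : Matrix (Fin n) (Fin n) ℂ} (hB : B.PosDef)
    {x : Fin n → ℂ} (h : star x ⬝ᵥ (B *ᵥ x) = 0) : x = 0 := by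
  by_contra hx
  exact (hB.dotProduct_mulVec_pos hx).ne' h

/-- For `B` positive definite and `H` Hermitian, `B⁻¹ H` is self-adjoint for the scalar product
defined by `B`, hence it is not nilpotent unless it vanishes. -/
theorem eq_zero_of_inv_mul_pow_eq_zero {B H : Matrix (Fin n) (Fin n) ℂ} (hB : B.PosDef)
    (hH : H.IsHermitian) (k : ℕ) (h : (B⁻¹ * H) ^ k = 0) : H = 0 := by
  have hBB : B * B⁻¹ = 1 := Matrix.mul_nonsing_inv _ ((Matrix.isUnit_iff_isUnit_det _).1 hB.isUnit)
  have hBB' : B⁻¹ * B = 1 := Matrix.nonsing_inv_mul _ ((Matrix.isUnit_iff_isUnit_det _).1 hB.isUnit)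
  have hBH : (B⁻¹)ᴴ = B⁻¹ := hB.inv.isHermitian
  have hstep : ∀ x, (B⁻¹ * H) *ᵥ ((B⁻¹ * H) *ᵥ x) = 0 → (B⁻¹ * H) *ᵥ x = 0 := by
    intro x hx
    refine eq_zero_of_dotProduct_mulVec_eq_zero hB ?_
    rw [Matrix.star_mulVec, ← Matrix.dotProduct_mulVec, Matrix.conjTranspose_mul, hBH, hH.eq,
      Matrix.mulVec_mulVec, Matrix.mulVec_mulVec]
    have : H * B⁻¹ * B * (B⁻¹ * H) = B * (B⁻¹ * H) * (B⁻¹ * H) := by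
      rw [← mul_assoc B, hBB, mul_assoc H, hBB']; simp
    rw [this, mul_assoc, ← Matrix.mulVec_mulVec, ← Matrix.mulVec_mulVec, hx]
    simp
  have hpow : ∀ k x, (B⁻¹ * H) ^ (k + 1) *ᵥ x = 0 → (B⁻¹ * H) *ᵥ x = 0 := by
    intro k
    induction k with
    | zero => intro x hx; simpa using hx
    | succ k ih =>
      intro x hx
      refine hstep x (ih _ ?_)
      rwa [Matrix.mulVec_mulVec, ← pow_succ]
  have h1 : B⁻¹ * H = 0 := by
    refine Matrix.ext_of_mulVec_single fun i => ?_
    rw [hpow k, Matrix.zero_mulVec]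
    rw [pow_succ, h, zero_mul, Matrix.zero_mulVec]
  calc H = B * (B⁻¹ * H) := by rw [← mul_assoc, hBB, one_mul]
    _ = 0 := by rw [h1, mul_zero]

/-! ### The quadratic matrix equation and the matrices `K_j` -/

theorem pencil_add (A : Fin d → Matrix (Fin n) (Fin n) ℂ) (a a' : Fin d → ℂ) :
    pencil A (a + a') = pencil A a + pencil A a' := by
  simp [pencil, add_smul, Finset.sum_add_distrib]

theorem pencil_smul (A : Fin d → Matrix (Fin n) (Fin n) ℂ) (c : ℂ) (a : Fin d → ℂ) :
    pencil A (c • a) = c • pencil A a := by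
  simp [pencil, Finset.smul_sum, smul_smul]

theorem pencil_conjTranspose {A : Fin d → Matrix (Fin n) (Fin n) ℂ} (hA : ∀ j, (A j).IsHermitian)
    (a : Fin d → ℂ) : (pencil A a)ᴴ = pencil A (fun j => conj (a j)) := by
  simp only [pencil, Matrix.conjTranspose_sum, Matrix.conjTranspose_smul, (hA _).eq]
  rfl

theorem pencil_middle {A : Fin d → Matrix (Fin n) (Fin n) ℂ} (hA : ∀ j, (A j).IsHermitian)
    (b : Fin d → ℝ) (a : Fin d → ℂ) :
    pencil A (middle b a) = pencil A (fun j => (b j : ℂ)) - pencil A a - (pencil A a)ᴴ := by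
  rw [pencil_conjTranspose hA]
  simp [pencil, middle, sub_smul, Finset.sum_sub_distrib]

theorem contDiff_pencil (A : Fin d → Matrix (Fin n) (Fin n) ℂ) : ContDiff ℝ ω (pencil A) := by
  unfold pencil
  exact ContDiff.sum fun j _ => (contDiff_apply ℝ ℂ j).smul contDiff_const

theorem contDiff_conjTranspose :
    ContDiff ℝ ω (fun X : Matrix (Fin n) (Fin n) ℂ => Xᴴ) :=
  (starL' ℝ : Matrix (Fin n) (Fin n) ℂ ≃L[ℝ] Matrix (Fin n) (Fin n) ℂ).contDiff

theorem isSmallSolution_iff {A : Fin d → Matrix (Fin n) (Fin n) ℂ} (hA : ∀ j, (A j).IsHermitian)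
    {b : Fin d → ℝ} {a : Fin d → ℂ} {X : Matrix (Fin n) (Fin n) ℂ} :
    IsSmallSolution A b a X ↔ pencil A (fun j => (b j : ℂ)) * X =
      pencil A a * (X - X ^ 2) + (pencil A a)ᴴ * (X - 1) ∧ ‖X‖ < 1 := by
  rw [IsSmallSolution, pencil_middle hA, ← sub_eq_zero (a := _ * X)]
  refine and_congr_left fun _ => ?_
  rw [show pencil A (fun j => (b j : ℂ)) * X - (pencil A a * (X - X ^ 2) +
    (pencil A a)ᴴ * (X - 1)) = pencil A a * X ^ 2 + (pencil A (fun j => (b j : ℂ)) - pencil A a -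
    (pencil A a)ᴴ) * X + (pencil A a)ᴴ by noncomm_ring]

/-- For `P = pencil A a` small compared with `B`, the equation is `X = B⁻¹ (…)` with a right-hand
side that is a contraction on the unit ball, whence uniqueness. -/
theorem IsSmallSolution.unique {A : Fin d → Matrix (Fin n) (Fin n) ℂ}
    (hA : ∀ j, (A j).IsHermitian) {b : Fin d → ℝ}
    (hB : (pencil A (fun j => (b j : ℂ))).PosDef) {a : Fin d → ℂ}
    (ha : ‖(pencil A (fun j => (b j : ℂ)))⁻¹‖ * (4 * ‖pencil A a‖) < 1)
    {X Y : Matrix (Fin n) (Fin n) ℂ} (hX : IsSmallSolution A b a X) (hY : IsSmallSolution A b a Y) :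
    X = Y := by
  obtain ⟨hX, hX1⟩ := (isSmallSolution_iff hA).1 hX
  obtain ⟨hY, hY1⟩ := (isSmallSolution_iff hA).1 hY
  set B := pencil A (fun j => (b j : ℂ))
  set P := pencil A a
  have hBB : B⁻¹ * B = 1 := Matrix.nonsing_inv_mul _ ((Matrix.isUnit_iff_isUnit_det _).1 hB.isUnit)
  have h1 : X - Y = B⁻¹ * (P * ((X - Y) - (X * (X - Y) + (X - Y) * Y)) + Pᴴ * (X - Y)) := by
    calc X - Y = B⁻¹ * (B * X - B * Y) := by rw [← mul_sub, ← mul_assoc, hBB, one_mul]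
      _ = _ := by rw [hX, hY]; congr 1; noncomm_ring
  have h2 : ‖X - Y‖ ≤ ‖B⁻¹‖ * (4 * ‖P‖) * ‖X - Y‖ := by
    have h3 : ‖(X - Y) - (X * (X - Y) + (X - Y) * Y)‖ ≤ 3 * ‖X - Y‖ := by
      have e1 : ‖X * (X - Y)‖ ≤ ‖X - Y‖ :=
        (norm_mul_le _ _).trans (by nlinarith [norm_nonneg (X - Y)])
      have e2 : ‖(X - Y) * Y‖ ≤ ‖X - Y‖ :=
        (norm_mul_le _ _).trans (by nlinarith [norm_nonneg (X - Y)])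
      have e3 := norm_sub_le (X - Y) (X * (X - Y) + (X - Y) * Y)
      have e4 := norm_add_le (X * (X - Y)) ((X - Y) * Y)
      linarith
    have h4 : ‖P * ((X - Y) - (X * (X - Y) + (X - Y) * Y)) + Pᴴ * (X - Y)‖ ≤
        4 * ‖P‖ * ‖X - Y‖ := by
      refine (norm_add_le _ _).trans ?_
      have e1 := norm_mul_le P ((X - Y) - (X * (X - Y) + (X - Y) * Y))
      have e2 := norm_mul_le Pᴴ (X - Y)
      rw [Matrix.l2_opNorm_conjTranspose] at e2
      nlinarith [mul_le_mul_of_nonneg_left h3 (norm_nonneg P)]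
    calc ‖X - Y‖ = ‖B⁻¹ * (P * ((X - Y) - (X * (X - Y) + (X - Y) * Y)) + Pᴴ * (X - Y))‖ :=
          congrArg _ h1
      _ ≤ ‖B⁻¹‖ * ‖P * ((X - Y) - (X * (X - Y) + (X - Y) * Y)) + Pᴴ * (X - Y)‖ := norm_mul_le _ _
      _ ≤ ‖B⁻¹‖ * (4 * ‖P‖ * ‖X - Y‖) := by gcongr
      _ = _ := by ring
  have h5 : ‖X - Y‖ = 0 := by
    by_contra h
    have : 0 < ‖X - Y‖ := lt_of_le_of_ne (norm_nonneg _) (Ne.symm h)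
    nlinarith
  exact sub_eq_zero.1 (norm_eq_zero.1 h5)

/-- The implicit function theorem at `(a, X) = (0, 0)`, where the derivative of the quadratic
equation in `X` is left multiplication by `B`. -/
theorem exists_contDiffAt_isSmallSolution {A : Fin d → Matrix (Fin n) (Fin n) ℂ} {b : Fin d → ℝ}
    (hB : (pencil A (fun j => (b j : ℂ))).PosDef) :
    ∃ ψ : (Fin d → ℂ) → Matrix (Fin n) (Fin n) ℂ, ContDiffAt ℝ ω ψ 0 ∧ ψ 0 = 0 ∧
      ∀ᶠ a in 𝓝 0, IsSmallSolution A b a (ψ a) := by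
  let f : (Fin d → ℂ) × Matrix (Fin n) (Fin n) ℂ → Matrix (Fin n) (Fin n) ℂ := fun p =>
    pencil A p.1 * p.2 ^ 2 + pencil A (middle b p.1) * p.2 + (pencil A p.1)ᴴ
  have hmid : ContDiff ℝ ω (middle b) := by
    unfold middle
    refine contDiff_pi.2 fun j => ContDiff.sub (by fun_prop) ?_
    exact Complex.conjCLE.contDiff.comp (by fun_prop)
  have hf : ContDiff ℝ ω f := by
    have h1 : ContDiff ℝ ω fun p : (Fin d → ℂ) × Matrix (Fin n) (Fin n) ℂ => pencil A p.1 :=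
      (contDiff_pencil A).comp contDiff_fst
    have h2 : ContDiff ℝ ω fun p : (Fin d → ℂ) × Matrix (Fin n) (Fin n) ℂ =>
        pencil A (middle b p.1) := (contDiff_pencil A).comp (hmid.comp contDiff_fst)
    exact ((h1.mul (contDiff_snd.pow 2)).add (h2.mul contDiff_snd)).add
      (contDiff_conjTranspose.comp h1)
  set B := pencil A (fun j => (b j : ℂ)) with hBdef
  have hdet := (Matrix.isUnit_iff_isUnit_det _).1 hB.isUnit
  let e : Matrix (Fin n) (Fin n) ℂ ≃ₗ[ℝ] Matrix (Fin n) (Fin n) ℂ :=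
    LinearEquiv.ofLinearMap (LinearMap.mulLeft ℝ B) (LinearMap.mulLeft ℝ B⁻¹)
      (by ext1 X; simp [← mul_assoc, Matrix.mul_nonsing_inv _ hdet])
      (by ext1 X; simp [← mul_assoc, Matrix.nonsing_inv_mul _ hdet])
  have hp0 : pencil A 0 = 0 := by simp [pencil]
  have hm0 : middle b 0 = fun j => (b j : ℂ) := by ext; simp [middle]
  have hf0 : ∀ X, f (0, X) = B * X := by
    intro X
    simp only [f, hp0, hm0]
    simp [hBdef]
  have hinv : (fderiv ℝ f (0, 0) ∘L ContinuousLinearMap.inr ℝ (Fin d → ℂ)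
      (Matrix (Fin n) (Fin n) ℂ)).IsInvertible := by
    refine ⟨e.toContinuousLinearEquiv, ?_⟩
    have h1 : HasFDerivAt (fun X => f (0, X)) (fderiv ℝ f (0, 0) ∘L ContinuousLinearMap.inr ℝ
        (Fin d → ℂ) (Matrix (Fin n) (Fin n) ℂ)) 0 :=
      HasFDerivAt.comp (0 : Matrix (Fin n) (Fin n) ℂ) (f := fun X => ((0 : Fin d → ℂ), X))
        (hf.contDiffAt.differentiableAt (by simp)).hasFDerivAt (hasFDerivAt_prodMk_right 0 0)
    have h2 : HasFDerivAt (fun X => f (0, X))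
        (e.toContinuousLinearEquiv : Matrix (Fin n) (Fin n) ℂ →L[ℝ] Matrix (Fin n) (Fin n) ℂ) 0 := by
      simp only [hf0]
      exact e.toContinuousLinearEquiv.hasFDerivAt
    exact h2.unique h1
  have hfc : ContDiffAt ℝ ω f (0, 0) := hf.contDiffAt
  refine ⟨hfc.implicitFunction (by simp) hinv, hfc.contDiffAt_implicitFunction (by simp) hinv,
    hfc.implicitFunction_apply_self (by simp) hinv, ?_⟩
  have hc : ContinuousAt (hfc.implicitFunction (by simp) hinv) 0 :=
    (hfc.contDiffAt_implicitFunction (by simp) hinv).continuousAt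
  have h0 : hfc.implicitFunction (by simp) hinv 0 = 0 :=
    hfc.implicitFunction_apply_self (by simp) hinv
  have hn := hc.norm.eventually_lt_const (u := 1) (by simp [h0])
  filter_upwards [hfc.eventually_apply_implicitFunction (by simp) hinv, hn] with a h1 h2
  refine ⟨?_, h2⟩
  rw [hf0, mul_zero] at h1
  exact h1

/-- For small `a` the small solution exists and is unique; it depends analytically on `a`. -/
theorem smallSolution_spec {A : Fin d → Matrix (Fin n) (Fin n) ℂ} (hA : ∀ j, (A j).IsHermitian)
    {b : Fin d → ℝ} (hB : (pencil A (fun j => (b j : ℂ))).PosDef) :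
    ContDiffAt ℝ ω (smallSolution A b) 0 ∧ smallSolution A b 0 = 0 ∧
      ∀ᶠ a in 𝓝 0, ∀ X, IsSmallSolution A b a X ↔ X = smallSolution A b a := by
  obtain ⟨ψ, hψ, hψ0, hev⟩ := exists_contDiffAt_isSmallSolution hB
  have hsm : ∀ᶠ a in 𝓝 (0 : Fin d → ℂ),
      ‖(pencil A (fun j => (b j : ℂ)))⁻¹‖ * (4 * ‖pencil A a‖) < 1 := by
    have hc : Continuous fun a : Fin d → ℂ =>
        ‖(pencil A (fun j => (b j : ℂ)))⁻¹‖ * (4 * ‖pencil A a‖) :=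
      continuous_const.mul (continuous_const.mul (contDiff_pencil A).continuous.norm)
    exact hc.continuousAt.eventually_lt_const (u := 1) (by simp [pencil])
  have hev2 : ∀ᶠ a in 𝓝 0, ∀ X, IsSmallSolution A b a X ↔ X = smallSolution A b a := by
    filter_upwards [hev, hsm] with a h1 h2 X
    have h3 : IsSmallSolution A b a (smallSolution A b a) := Classical.epsilon_spec ⟨_, h1⟩
    exact ⟨fun h => h.unique hA hB h2 h3, fun h => h ▸ h3⟩
  have heq : ψ =ᶠ[𝓝 0] smallSolution A b := by
    filter_upwards [hev, hev2] with a h1 h2 using (h2 _).1 h1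
  exact ⟨hψ.congr_of_eventuallyEq heq.symm, heq.self_of_nhds ▸ hψ0, hev2⟩

theorem norm_mul_mul_conjTranspose_le (X A : Matrix (Fin n) (Fin n) ℂ) :
    ‖Xᴴ * A * X‖ ≤ ‖X‖ ^ 2 * ‖A‖ := by
  calc ‖Xᴴ * A * X‖ ≤ ‖Xᴴ‖ * ‖A‖ * ‖X‖ := norm_mul₃_le
    _ = _ := by rw [Matrix.l2_opNorm_conjTranspose]; ring

theorem summable_Kmat (A : Matrix (Fin n) (Fin n) ℂ) {X : Matrix (Fin n) (Fin n) ℂ} (hX : ‖X‖ < 1) :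
    Summable fun r : ℕ => Xᴴ ^ r * A * X ^ r := by
  have hle : ∀ r : ℕ, ‖Xᴴ ^ r * A * X ^ r‖ ≤ (‖X‖ ^ 2) ^ r * ‖A‖ := by
    intro r
    induction r with
    | zero => simp
    | succ r ih =>
      have : Xᴴ ^ (r + 1) * A * X ^ (r + 1) = Xᴴ * (Xᴴ ^ r * A * X ^ r) * X := by
        rw [pow_succ', pow_succ]; noncomm_ring
      calc ‖Xᴴ ^ (r + 1) * A * X ^ (r + 1)‖ ≤ ‖X‖ ^ 2 * ‖Xᴴ ^ r * A * X ^ r‖ :=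
            this ▸ norm_mul_mul_conjTranspose_le _ _
        _ ≤ ‖X‖ ^ 2 * ((‖X‖ ^ 2) ^ r * ‖A‖) := mul_le_mul_of_nonneg_left ih (sq_nonneg _)
        _ = (‖X‖ ^ 2) ^ (r + 1) * ‖A‖ := by ring
  refine Summable.of_norm_bounded ?_ hle
  exact (summable_geometric_of_lt_one (by positivity)
    (pow_lt_one₀ (norm_nonneg _) hX two_ne_zero)).mul_right _

/-- The Stein equation satisfied by `K_j`. -/
theorem Kmat_eq (A : Fin d → Matrix (Fin n) (Fin n) ℂ) {X : Matrix (Fin n) (Fin n) ℂ}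
    (hX : ‖X‖ < 1) (j : Fin d) : Kmat A X j = A j + Xᴴ * Kmat A X j * X := by
  have hs := summable_Kmat (A j) hX
  have h1 : Xᴴ * Kmat A X j * X = ∑' r : ℕ, Xᴴ ^ (r + 1) * A j * X ^ (r + 1) := by
    rw [Kmat, ← hs.tsum_mul_left, ← (hs.mul_left _).tsum_mul_right]
    refine tsum_congr fun r => ?_
    rw [pow_succ', pow_succ]; noncomm_ring
  rw [h1, Kmat, hs.tsum_eq_zero_add]
  simp

theorem Kmat_isHermitian {A : Fin d → Matrix (Fin n) (Fin n) ℂ} (hA : ∀ j, (A j).IsHermitian)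
    (X : Matrix (Fin n) (Fin n) ℂ) (j : Fin d) : (Kmat A X j).IsHermitian := by
  rw [Matrix.IsHermitian, Kmat, Matrix.conjTranspose_tsum]
  refine tsum_congr fun r => ?_
  simp [Matrix.conjTranspose_mul, Matrix.conjTranspose_pow, (hA j).eq, mul_assoc]

/-- `K_j` is the value at `A_j` of the inverse of the operator `Z ↦ Z - ᵗX̄ Z X`; hence it depends
analytically on `X`. -/
theorem contDiffAt_Kmat (A : Fin d → Matrix (Fin n) (Fin n) ℂ) {X : Matrix (Fin n) (Fin n) ℂ}
    (hX : ‖X‖ < 1) (j : Fin d) : ContDiffAt ℝ ω (fun Y => Kmat A Y j) X := by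
  let T : Matrix (Fin n) (Fin n) ℂ → Matrix (Fin n) (Fin n) ℂ →L[ℝ] Matrix (Fin n) (Fin n) ℂ :=
    fun Y => ContinuousLinearMap.mulLeftRight ℝ (Matrix (Fin n) (Fin n) ℂ) Yᴴ Y
  have hT : ContDiff ℝ ω T :=
    ((ContinuousLinearMap.mulLeftRight ℝ (Matrix (Fin n) (Fin n) ℂ)).contDiff.comp
      contDiff_conjTranspose).clm_apply contDiff_id
  have hTn : ∀ Y, ‖Y‖ < 1 → ‖T Y‖ < 1 := by
    intro Y hY
    refine lt_of_le_of_lt (ContinuousLinearMap.opNorm_le_bound _ (by positivity) fun Z => ?_)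
      (pow_lt_one₀ (norm_nonneg Y) hY two_ne_zero)
    exact norm_mul_mul_conjTranspose_le _ _
  have hK : ∀ Y, ‖Y‖ < 1 → Ring.inverse (1 - T Y) (A j) = Kmat A Y j := by
    intro Y hY
    have hu : IsUnit (1 - T Y) := isUnit_one_sub_of_norm_lt_one (x := T Y) (hTn Y hY)
    have h1 : (1 - T Y) (Kmat A Y j) = A j := by
      have := Kmat_eq A hY j
      have h2 : T Y (Kmat A Y j) = Yᴴ * Kmat A Y j * Y := rfl
      rw [sub_apply, h2, one_apply_eq_self]
      exact sub_eq_of_eq_add this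
    rw [← h1, ← mul_apply_eq_comp, Ring.inverse_mul_cancel _ hu]
    rfl
  have hu : IsUnit (1 - T X) := isUnit_one_sub_of_norm_lt_one (x := T X) (hTn X hX)
  have h1 : ContDiffAt ℝ ω (fun Y => Ring.inverse (1 - T Y) (A j)) X := by
    have h2 : ContDiffAt ℝ ω (Ring.inverse : (Matrix (Fin n) (Fin n) ℂ →L[ℝ] _) → _) (1 - T X) := by
      have := contDiffAt_ringInverse ℝ (n := ω)
        (R := Matrix (Fin n) (Fin n) ℂ →L[ℝ] Matrix (Fin n) (Fin n) ℂ) hu.unit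
      rwa [hu.unit_spec] at this
    exact (ContDiffAt.comp X h2 (contDiff_const.sub hT).contDiffAt).clm_apply contDiffAt_const
  refine h1.congr_of_eventuallyEq ?_
  filter_upwards [continuous_norm.continuousAt.eventually_lt_const hX] with Y hY
  exact (hK Y hY).symm

/-! ### The matrices of the explicit lifts -/

theorem isUnit_one_sub_smul {X : Matrix (Fin n) (Fin n) ℂ} (hX : ‖X‖ < 1) {ζ : ℂ} (hζ : ‖ζ‖ ≤ 1) :
    IsUnit (1 - ζ • X) := by
  refine isUnit_one_sub_of_norm_lt_one (x := ζ • X) ?_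
  rw [norm_smul]
  exact (mul_le_of_le_one_left (norm_nonneg _) hζ).trans_lt hX

theorem inv_mul_cancel_one_sub_smul {X : Matrix (Fin n) (Fin n) ℂ} (hX : ‖X‖ < 1) {ζ : ℂ}
    (hζ : ‖ζ‖ ≤ 1) : (1 - ζ • X)⁻¹ * (1 - ζ • X) = 1 :=
  Matrix.nonsing_inv_mul _ ((Matrix.isUnit_iff_isUnit_det _).1 (isUnit_one_sub_smul hX hζ))

theorem mul_inv_cancel_one_sub_smul {X : Matrix (Fin n) (Fin n) ℂ} (hX : ‖X‖ < 1) {ζ : ℂ}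
    (hζ : ‖ζ‖ ≤ 1) : (1 - ζ • X) * (1 - ζ • X)⁻¹ = 1 :=
  Matrix.mul_nonsing_inv _ ((Matrix.isUnit_iff_isUnit_det _).1 (isUnit_one_sub_smul hX hζ))

theorem hasDerivAt_inv_one_sub_smul {X : Matrix (Fin n) (Fin n) ℂ} (hX : ‖X‖ < 1) {ζ : ℂ}
    (hζ : ‖ζ‖ ≤ 1) : HasDerivAt (fun ζ : ℂ => (1 - ζ • X)⁻¹)
      ((1 - ζ • X)⁻¹ * X * (1 - ζ • X)⁻¹) ζ := by
  have hu := isUnit_one_sub_smul hX hζ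
  have h1 : HasDerivAt (fun ζ : ℂ => 1 - ζ • X) (-X) ζ := by
    simpa using ((hasDerivAt_id ζ).smul_const X).const_sub 1
  have h2 := hasFDerivAt_ringInverse (𝕜 := ℂ) hu.unit
  rw [hu.unit_spec] at h2
  have h4 : ((hu.unit⁻¹ : (Matrix (Fin n) (Fin n) ℂ)ˣ) : Matrix (Fin n) (Fin n) ℂ) =
      (1 - ζ • X)⁻¹ := by
    rw [Matrix.nonsing_inv_eq_ringInverse, ← Ring.inverse_unit, hu.unit_spec]
  have h5 : (fun ζ : ℂ => (1 - ζ • X)⁻¹) = Ring.inverse ∘ fun ζ : ℂ => 1 - ζ • X := by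
    ext1 ζ; exact Matrix.nonsing_inv_eq_ringInverse _
  rw [h4] at h2
  rw [h5]
  exact (h2.comp_hasDerivAt ζ h1).congr_deriv (by simp [ContinuousLinearMap.mulLeftRight_apply])

theorem _root_.HasDerivAt.mulVec_const {G : ℂ → Matrix (Fin n) (Fin n) ℂ}
    {G' : Matrix (Fin n) (Fin n) ℂ} {z : ℂ} (hG : HasDerivAt G G' z) (v : Fin n → ℂ) :
    HasDerivAt (fun ζ => G ζ *ᵥ v) (G' *ᵥ v) z := by
  let L : Matrix (Fin n) (Fin n) ℂ →L[ℂ] (Fin n → ℂ) :=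
    LinearMap.toContinuousLinearMap ((Matrix.mulVecBilin ℂ ℂ).flip v)
  exact L.hasFDerivAt.comp_hasDerivAt z hG

theorem _root_.HasDerivAt.const_vecMul {G : ℂ → Matrix (Fin n) (Fin n) ℂ}
    {G' : Matrix (Fin n) (Fin n) ℂ} {z : ℂ}
    (hG : HasDerivAt G G' z) (v : Fin n → ℂ) :
    HasDerivAt (fun ζ => v ᵥ* G ζ) (v ᵥ* G') z := by
  let L : Matrix (Fin n) (Fin n) ℂ →L[ℂ] (Fin n → ℂ) :=
    LinearMap.toContinuousLinearMap (Matrix.vecMulBilin ℂ ℂ v)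
  exact L.hasFDerivAt.comp_hasDerivAt z hG

theorem _root_.HasDerivAt.const_dotProduct {𝕜 : Type*} [NontriviallyNormedField 𝕜]
    [NormedAlgebra 𝕜 ℂ] {G : 𝕜 → Fin n → ℂ} {G' : Fin n → ℂ} {z : 𝕜}
    (hG : HasDerivAt G G' z) (v : Fin n → ℂ) :
    HasDerivAt (fun ζ => v ⬝ᵥ G ζ) (v ⬝ᵥ G') z := by
  simp only [dotProduct]
  exact HasDerivAt.fun_sum fun i _ => (hasDerivAt_pi.1 hG i).const_mul (v i)

theorem conj_star_dotProduct_mulVec (M : Matrix (Fin n) (Fin n) ℂ) (v : Fin n → ℂ) :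
    conj (star v ⬝ᵥ (M *ᵥ v)) = star v ⬝ᵥ (Mᴴ *ᵥ v) := by
  have : conj (star v ⬝ᵥ (M *ᵥ v)) = star (star v ⬝ᵥ (M *ᵥ v)) := rfl
  rw [this, ← Matrix.star_dotProduct_star, star_star, Matrix.star_mulVec, Matrix.dotProduct_mulVec,
    dotProduct_comm]

theorem ofReal_re_of_isHermitian {M : Matrix (Fin n) (Fin n) ℂ} (hM : M.IsHermitian)
    (v : Fin n → ℂ) : ((star v ⬝ᵥ (M *ᵥ v)).re : ℂ) = star v ⬝ᵥ (M *ᵥ v) := by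
  rw [← Complex.conj_eq_iff_re, conj_star_dotProduct_mulVec, hM.eq]

theorem star_mulVec_dotProduct_mulVec (S M : Matrix (Fin n) (Fin n) ℂ) (v : Fin n → ℂ) :
    star (S *ᵥ v) ⬝ᵥ (M *ᵥ (S *ᵥ v)) = star v ⬝ᵥ ((Sᴴ * M * S) *ᵥ v) := by
  rw [Matrix.star_mulVec, ← Matrix.dotProduct_mulVec, Matrix.mulVec_mulVec, Matrix.mulVec_mulVec,
    mul_assoc]

theorem sum_smul_delDefining (A : Fin d → Matrix (Fin n) (Fin n) ℂ) (c : Fin d → ℂ)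
    (p : (Fin n → ℂ) × (Fin d → ℂ)) :
    ∑ j, c j • delDefining A j p = (-(star p.1 ᵥ* pencil A c), fun j => c j / 2) := by
  refine Prod.ext ?_ ?_
  · simp only [delDefining, Prod.fst_sum, Prod.smul_fst, pencil, Matrix.vecMul_sum,
      Matrix.vecMul_smul, smul_neg, Finset.sum_neg_distrib]
  · ext i
    simp only [delDefining, Prod.snd_sum, Prod.smul_snd, Finset.sum_apply, Pi.smul_apply,
      Pi.single_apply, smul_eq_mul]
    simp [div_eq_mul_inv]

/-- The matrix with `h ζ = U - dilation X ζ U`. -/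
def dilation (X : Matrix (Fin n) (Fin n) ℂ) (ζ : ℂ) : Matrix (Fin n) (Fin n) ℂ :=
  ζ • ((1 - ζ • X)⁻¹ * (1 - X))

/-- The matrix of the form in `U` that gives `g_j ζ`, where `A` and `K` stand for `A_j`, `K_j`. -/
def gForm (A K X : Matrix (Fin n) (Fin n) ℂ) (ζ : ℂ) : Matrix (Fin n) (Fin n) ℂ :=
  A - (2 : ℂ) • (A * dilation X ζ) + (Xᴴ * K - K * X) +
    (1 - Xᴴ) * K * (1 + (2 * ζ) • (X * (1 - ζ • X)⁻¹)) * (1 - X)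

/-- The polynomial matrix with `h̃ ζ = ᵗŪ (hTildeForm ζ)`; here `P` and `D` stand for the outer and
the middle coefficient of the quadratic equation. -/
def hTildeForm (P D X : Matrix (Fin n) (Fin n) ℂ) (ζ : ℂ) : Matrix (Fin n) (Fin n) ℂ :=
  -(P + ζ • D + ζ ^ 2 • Pᴴ) + (1 - Xᴴ) * (D + Xᴴ * Pᴴ + ζ • Pᴴ)

section Forms

variable {X : Matrix (Fin n) (Fin n) ℂ}

theorem hasDerivAt_dilation (hX : ‖X‖ < 1) {ζ : ℂ} (hζ : ‖ζ‖ ≤ 1) :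
    HasDerivAt (dilation X) ((1 - ζ • X)⁻¹ * (1 - X) +
      ζ • ((1 - ζ • X)⁻¹ * X * (1 - ζ • X)⁻¹ * (1 - X))) ζ := by
  have h : HasDerivAt (dilation X) _ ζ :=
    (hasDerivAt_id ζ).smul ((hasDerivAt_inv_one_sub_smul hX hζ).mul_const (1 - X))
  refine h.congr_deriv ?_
  rw [id, one_smul, add_comm]

theorem dilation_one (hX : ‖X‖ < 1) : dilation X 1 = 1 := by
  have := inv_mul_cancel_one_sub_smul hX (ζ := 1) (by simp)
  rw [one_smul] at this
  simp [dilation, this]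

theorem hasDerivAt_dilation_one (hX : ‖X‖ < 1) : HasDerivAt (dilation X) (1 - X)⁻¹ 1 := by
  have h := hasDerivAt_dilation hX (ζ := 1) (by simp)
  have h1 := inv_mul_cancel_one_sub_smul hX (ζ := 1) (by simp)
  simp only [one_smul] at h h1
  convert h using 1
  rw [h1, mul_assoc _ _ (1 - X), h1]
  rw [mul_sub, mul_one] at h1
  rw [mul_one]; linear_combination (norm := abel) h1

theorem hasDerivAt_gForm (A K : Matrix (Fin n) (Fin n) ℂ) (hX : ‖X‖ < 1) {ζ : ℂ} (hζ : ‖ζ‖ ≤ 1)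
    {S' : Matrix (Fin n) (Fin n) ℂ} (hS : HasDerivAt (dilation X) S' ζ) :
    HasDerivAt (gForm A K X) (-((2 : ℂ) • (A * S')) + (1 - Xᴴ) * K *
      ((2 : ℂ) • (X * (1 - ζ • X)⁻¹ + ζ • (X * ((1 - ζ • X)⁻¹ * X * (1 - ζ • X)⁻¹)))) *
      (1 - X)) ζ := by
  have h1 := (hasDerivAt_inv_one_sub_smul hX hζ).const_mul X
  have h2 := (((hasDerivAt_id ζ).const_mul 2).smul h1).const_add (1 : Matrix (Fin n) (Fin n) ℂ)
  have h3 := ((h2.const_mul ((1 - Xᴴ) * K)).mul_const (1 - X))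
  have h4 := (((hS.const_mul A).const_smul (2 : ℂ)).const_sub A).add_const (Xᴴ * K - K * X)
  have h : HasDerivAt (gForm A K X) _ ζ := h4.add h3
  refine h.congr_deriv ?_
  rw [id, mul_one, smul_add, smul_smul, add_comm ((2 * ζ) • _)]

theorem hasDerivAt_gForm_one {A K : Matrix (Fin n) (Fin n) ℂ} (hX : ‖X‖ < 1)
    (hK : K = A + Xᴴ * K * X) : HasDerivAt (gForm A K X) (-((2 : ℂ) • K)) 1 := by
  have h := hasDerivAt_gForm A K hX (ζ := 1) (by simp) (hasDerivAt_dilation_one hX)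
  have h1 := inv_mul_cancel_one_sub_smul hX (ζ := 1) (by simp)
  have h2 := mul_inv_cancel_one_sub_smul hX (ζ := 1) (by simp)
  simp only [one_smul] at h h1 h2
  convert h using 1
  set R := (1 - X)⁻¹
  have h3 : X * R = R - 1 := by rw [← h2]; noncomm_ring
  have h4 : X * R + X * (R * X * R) = X * R * R := by
    have : 1 + X * R = R := by rw [h3]; abel
    calc _ = X * R * (1 + X * R) := by noncomm_ring
      _ = _ := by rw [this]
  have h5 : A = K - Xᴴ * K * X := eq_sub_of_add_eq hK.symm
  have h6 : K = K * (1 - X) * R := by rw [mul_assoc, h2, mul_one]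
  rw [h4, mul_smul_comm, smul_mul_assoc, ← smul_neg, ← smul_neg, ← smul_add]
  congr 1
  have h7 : (1 - Xᴴ) * K * (X * R * R) * (1 - X) = (1 - Xᴴ) * K * X * R := by
    calc _ = (1 - Xᴴ) * K * X * R * (R * (1 - X)) := by noncomm_ring
      _ = _ := by rw [h1, mul_one]
  rw [h7, h5]
  nth_rewrite 1 [h6]
  noncomm_ring

theorem gForm_one {A K : Matrix (Fin n) (Fin n) ℂ} (hX : ‖X‖ < 1)
    (hK : K = A + Xᴴ * K * X) : gForm A K X 1 = 0 := by
  have h1 := inv_mul_cancel_one_sub_smul hX (ζ := 1) (by simp)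
  rw [one_smul] at h1
  have h5 : A = K - Xᴴ * K * X := eq_sub_of_add_eq hK.symm
  have h7 : (1 - Xᴴ) * K * (1 + (2 * 1 : ℂ) • (X * (1 - (1 : ℂ) • X)⁻¹)) * (1 - X) =
      (1 - Xᴴ) * K * (1 + X) := by
    rw [one_smul, mul_one]
    calc _ = (1 - Xᴴ) * K * ((1 - X) + (2 : ℂ) • (X * ((1 - X)⁻¹ * (1 - X)))) := by
          simp only [mul_add, add_mul, mul_one, mul_smul_comm, smul_mul_assoc, mul_assoc]
      _ = _ := by rw [h1, mul_one, two_smul]; noncomm_ring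
  rw [gForm, dilation_one hX, h7, h5, two_smul]
  noncomm_ring

/-- On the unit circle the real part of `gForm` is the form `A` evaluated at `1 - dilation X ζ`.
This rests on the resolvent identity for `A = K - ᵗX̄ K X` when `ζ ζ̄ = 1`. -/
theorem gForm_add_conjTranspose {A K : Matrix (Fin n) (Fin n) ℂ} (hX : ‖X‖ < 1)
    (hA : A.IsHermitian) (hKH : K.IsHermitian) (hK : K = A + Xᴴ * K * X) {ζ : ℂ} (hζ : ‖ζ‖ = 1) :
    gForm A K X ζ + (gForm A K X ζ)ᴴ =
      (2 : ℂ) • ((1 - dilation X ζ)ᴴ * A * (1 - dilation X ζ)) := by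
  have h1 := mul_inv_cancel_one_sub_smul hX hζ.le
  have h1' := congrArg Matrix.conjTranspose h1
  have hζζ : conj ζ * ζ = 1 := by
    rw [mul_comm, Complex.mul_conj, Complex.normSq_eq_norm_sq, hζ]; simp
  rw [Matrix.conjTranspose_mul, Matrix.conjTranspose_one] at h1'
  have h5 : A = K - Xᴴ * K * X := eq_sub_of_add_eq hK.symm
  unfold gForm dilation
  set R := (1 - ζ • X)⁻¹
  have hZ : (1 - ζ • X)ᴴ = 1 - conj ζ • Xᴴ := by
    simp [Matrix.conjTranspose_sub, Matrix.conjTranspose_smul]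
  -- The resolvent identity.
  have hres : Rᴴ * A * R = K + ζ • (K * X * R) + conj ζ • (Rᴴ * Xᴴ * K) := by
    have e1 : A = (1 - ζ • X)ᴴ * K * (1 - ζ • X) + ζ • ((1 - ζ • X)ᴴ * K * X) +
        conj ζ • (Xᴴ * K * (1 - ζ • X)) := by
      rw [hZ, h5]
      simp only [sub_mul, mul_sub, one_mul, mul_one, smul_mul_assoc, mul_smul_comm, smul_sub,
        smul_smul, hζζ, mul_comm ζ (conj ζ), one_smul]
      abel
    calc Rᴴ * A * R = (Rᴴ * (1 - ζ • X)ᴴ) * K * ((1 - ζ • X) * R) +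
          ζ • ((Rᴴ * (1 - ζ • X)ᴴ) * K * X * R) +
          conj ζ • (Rᴴ * Xᴴ * K * ((1 - ζ • X) * R)) := by
            nth_rewrite 1 [e1]
            simp only [mul_add, add_mul, mul_smul_comm, smul_mul_assoc, mul_assoc]
      _ = _ := by rw [h1, h1']; simp only [one_mul, mul_one]
  have hSS : (ζ • (R * (1 - X)))ᴴ * A * (ζ • (R * (1 - X))) =
      (1 - Xᴴ) * (K + ζ • (K * X * R) + conj ζ • (Rᴴ * Xᴴ * K)) * (1 - X) := by
    rw [← hres, Matrix.conjTranspose_smul, Matrix.conjTranspose_mul, Matrix.conjTranspose_sub,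
      Matrix.conjTranspose_one]
    simp only [smul_mul_assoc, mul_smul_comm, smul_smul]
    rw [show ζ * star ζ = 1 by rw [mul_comm]; exact hζζ, one_smul]
    simp only [mul_assoc]
  have hexp : ∀ S, (1 - S)ᴴ * A * (1 - S) = A - A * S - Sᴴ * A + Sᴴ * A * S := by
    intro S
    rw [Matrix.conjTranspose_sub, Matrix.conjTranspose_one]; noncomm_ring
  rw [hexp, hSS]
  set S := ζ • (R * (1 - X))
  simp only [Matrix.conjTranspose_add, Matrix.conjTranspose_sub, Matrix.conjTranspose_mul,
    Matrix.conjTranspose_smul, Matrix.conjTranspose_one, Matrix.conjTranspose_conjTranspose,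
    hA.eq, hKH.eq, star_mul', star_ofNat, Complex.star_def]
  simp only [mul_add, add_mul, smul_add, smul_sub, mul_one, one_mul, mul_smul_comm,
    smul_mul_assoc, two_smul, sub_mul, mul_sub, smul_smul, mul_assoc, two_mul, add_smul]
  abel

section hTilde

variable {P D : Matrix (Fin n) (Fin n) ℂ}

/-- The adjoint of the quadratic equation. -/
theorem eq_neg_conjTranspose_mul_sub (h : P * X ^ 2 + D * X + Pᴴ = 0) (hD : D.IsHermitian) :
    P = -(Xᴴ * D) - Xᴴ * Xᴴ * Pᴴ := by
  have h1 := congrArg Matrix.conjTranspose h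
  simp only [Matrix.conjTranspose_add, Matrix.conjTranspose_mul, Matrix.conjTranspose_pow,
    Matrix.conjTranspose_conjTranspose, Matrix.conjTranspose_zero, hD.eq] at h1
  rw [sq] at h1
  linear_combination (norm := noncomm_ring) h1

theorem hTildeForm_one (h : P * X ^ 2 + D * X + Pᴴ = 0) (hD : D.IsHermitian) :
    hTildeForm P D X 1 = 0 := by
  simp only [hTildeForm, one_smul, one_pow]
  linear_combination (norm := noncomm_ring)
    (-1 : Matrix (Fin n) (Fin n) ℂ) * eq_neg_conjTranspose_mul_sub h hD

theorem hasDerivAt_hTildeForm (ζ : ℂ) :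
    HasDerivAt (hTildeForm P D X) (-(D + (2 * ζ) • Pᴴ) + (1 - Xᴴ) * Pᴴ) ζ := by
  have h1 := (((hasDerivAt_id ζ).smul_const D).const_add P).add
    (((hasDerivAt_id ζ).pow 2).smul_const Pᴴ)
  have h2 := (((hasDerivAt_id ζ).smul_const Pᴴ).const_add (D + Xᴴ * Pᴴ)).const_mul (1 - Xᴴ)
  have h : HasDerivAt (hTildeForm P D X) _ ζ := h1.neg.add h2
  refine h.congr_deriv ?_
  simp only [id, one_smul, Nat.cast_ofNat, mul_one, Nat.add_one_sub_one, pow_one]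

theorem one_sub_mul_deriv_hTildeForm (h : P * X ^ 2 + D * X + Pᴴ = 0) (hD : D.IsHermitian) :
    (1 - Xᴴ) * (-(D + (2 * (1 : ℂ)) • Pᴴ) + (1 - Xᴴ) * Pᴴ) = -(P + D + Pᴴ) := by
  rw [mul_one, two_smul]
  linear_combination (norm := noncomm_ring) eq_neg_conjTranspose_mul_sub h hD

/-- On the unit circle `hTildeForm` agrees with the nonholomorphic expression for `h̃`: the
quadratic equation makes `1 - ζ̄ ᵗX̄` a left factor of `ζ̄ P + D + ζ ᵗP̄`. -/
theorem hTildeForm_eq (hX : ‖X‖ < 1) (h : P * X ^ 2 + D * X + Pᴴ = 0) (hD : D.IsHermitian) {ζ : ℂ}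
    (hζ : ‖ζ‖ = 1) : hTildeForm P D X ζ =
      -(ζ • ((1 - dilation X ζ)ᴴ * (conj ζ • P + D + ζ • Pᴴ))) := by
  have h1 := congrArg Matrix.conjTranspose (mul_inv_cancel_one_sub_smul hX hζ.le)
  have hζζ : conj ζ * ζ = 1 := by
    rw [mul_comm, Complex.mul_conj, Complex.normSq_eq_norm_sq, hζ]; simp
  rw [Matrix.conjTranspose_mul, Matrix.conjTranspose_one] at h1
  have hZ : (1 - ζ • X)ᴴ = 1 - conj ζ • Xᴴ := by
    simp [Matrix.conjTranspose_sub, Matrix.conjTranspose_smul]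
  have hfac : conj ζ • P + D + ζ • Pᴴ = (1 - ζ • X)ᴴ * (D + Xᴴ * Pᴴ + ζ • Pᴴ) := by
    rw [hZ]
    nth_rewrite 1 [eq_neg_conjTranspose_mul_sub h hD]
    simp only [sub_mul, mul_add, one_mul, smul_mul_assoc, mul_smul_comm, smul_sub, smul_smul,
      smul_neg, mul_comm ζ (conj ζ), hζζ, one_smul, mul_assoc]
    abel
  have hS : (dilation X ζ)ᴴ = conj ζ • ((1 - Xᴴ) * ((1 - ζ • X)⁻¹)ᴴ) := by
    simp [dilation, Matrix.conjTranspose_smul, Matrix.conjTranspose_mul, Matrix.conjTranspose_sub]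
  have hSm : ζ • ((dilation X ζ)ᴴ * (conj ζ • P + D + ζ • Pᴴ)) =
      (1 - Xᴴ) * (D + Xᴴ * Pᴴ + ζ • Pᴴ) := by
    rw [hS, hfac, smul_mul_assoc, smul_smul, mul_comm ζ, hζζ, one_smul, mul_assoc (1 - Xᴴ),
      ← mul_assoc _ ((1 - ζ • X)ᴴ), h1, one_mul]
  rw [Matrix.conjTranspose_sub, Matrix.conjTranspose_one, sub_mul, smul_sub, hSm, one_mul,
    hTildeForm, smul_add, smul_add, smul_smul, smul_smul, mul_comm ζ (conj ζ), hζζ, one_smul, sq]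
  abel

end hTilde

end Forms

/-! ### The explicit lifts -/

section ExplicitLift

/-- The lift `(h, g, h̃, g̃)` with parameters `a` and `U`, written with the solution `X` of the
quadratic equation; the formula for `h̃` is the polynomial one. -/
def explicitLift (A : Fin d → Matrix (Fin n) (Fin n) ℂ) (b : Fin d → ℝ) (a : Fin d → ℂ)
    (X : Matrix (Fin n) (Fin n) ℂ) (U : Fin n → ℂ) :
    ℂ → ((Fin n → ℂ) × (Fin d → ℂ)) × ((Fin n → ℂ) × (Fin d → ℂ)) := fun ζ =>
  ((U - dilation X ζ *ᵥ U, fun j => star U ⬝ᵥ (gForm (A j) (Kmat A X j) X ζ *ᵥ U)),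
    (star U ᵥ* hTildeForm (pencil A a) (pencil A (middle b a)) X ζ,
      fun j => (a j + middle b a j * ζ + conj (a j) * ζ ^ 2) / 2))

variable {A : Fin d → Matrix (Fin n) (Fin n) ℂ} {b : Fin d → ℝ} {a : Fin d → ℂ}
  {X : Matrix (Fin n) (Fin n) ℂ}

theorem hasDerivAt_explicitLift (U : Fin n → ℂ) {ζ : ℂ} {S' H' : Matrix (Fin n) (Fin n) ℂ}
    {G' : Fin d → Matrix (Fin n) (Fin n) ℂ} (hS : HasDerivAt (dilation X) S' ζ)
    (hG : ∀ j, HasDerivAt (gForm (A j) (Kmat A X j) X) (G' j) ζ)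
    (hH : HasDerivAt (hTildeForm (pencil A a) (pencil A (middle b a)) X) H' ζ) :
    HasDerivAt (explicitLift A b a X U)
      ((-(S' *ᵥ U), fun j => star U ⬝ᵥ (G' j *ᵥ U)),
        (star U ᵥ* H', fun j => (middle b a j + conj (a j) * (2 * ζ)) / 2)) ζ := by
  refine HasDerivAt.prodMk (HasDerivAt.prodMk ((hS.mulVec_const U).const_sub U)
    (hasDerivAt_pi.2 fun j => ((hG j).mulVec_const U).const_dotProduct _))
    (HasDerivAt.prodMk (hH.const_vecMul _) (hasDerivAt_pi.2 fun j => ?_))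
  have h := ((((hasDerivAt_id ζ).const_mul (middle b a j)).const_add (a j)).add
    (((hasDerivAt_id ζ).pow 2).const_mul (conj (a j)))).div_const 2
  exact h.congr_deriv (by simp)

theorem conj_middle (b : Fin d → ℝ) (a : Fin d → ℂ) (j : Fin d) :
    conj (middle b a j) = middle b a j := by
  simp only [middle, map_sub, Complex.conj_conj, Complex.conj_ofReal]; ring

theorem pencil_middle_isHermitian (hA : ∀ j, (A j).IsHermitian) :
    (pencil A (middle b a)).IsHermitian := by
  rw [Matrix.IsHermitian, pencil_conjTranspose hA]
  simp only [conj_middle]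

/-- On the unit circle the coefficients `c_j = a_j ζ̄ + (b_j - a_j - ā_j) + ā_j ζ` are real. -/
theorem exists_real_coeff (b : Fin d → ℝ) (a : Fin d → ℂ) (ζ : ℂ) :
    ∃ c : Fin d → ℝ, ∀ j, (c j : ℂ) = a j * conj ζ + middle b a j + conj (a j) * ζ := by
  refine ⟨fun j => (a j * conj ζ + middle b a j + conj (a j) * ζ).re, fun j => ?_⟩
  rw [← Complex.conj_eq_iff_re]
  simp only [map_add, map_mul, Complex.conj_conj, conj_middle]
  ring

theorem coeff_ne_zero {j : Fin d} (hj : 4 * ‖a‖ < |b j|) {ζ : ℂ} (hζ : ‖ζ‖ = 1) :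
    a j * conj ζ + middle b a j + conj (a j) * ζ ≠ 0 := by
  intro h
  have h1 : (b j : ℂ) = a j + conj (a j) - a j * conj ζ - conj (a j) * ζ := by
    rw [middle] at h; linear_combination h
  have h2 := congrArg norm h1
  have h3 : ‖a j + conj (a j) - a j * conj ζ - conj (a j) * ζ‖ ≤ 4 * ‖a j‖ := by
    refine (norm_sub_le _ _).trans ?_
    have e1 := norm_sub_le (a j + conj (a j)) (a j * conj ζ)
    have e2 := norm_add_le (a j) (conj (a j))
    have e3 : ‖conj (a j) * ζ‖ = ‖a j‖ := by rw [norm_mul, RCLike.norm_conj, hζ, mul_one]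
    have e4 : ‖a j * conj ζ‖ = ‖a j‖ := by rw [norm_mul, RCLike.norm_conj, hζ, mul_one]
    rw [RCLike.norm_conj] at e2
    linarith
  rw [Complex.norm_real, Real.norm_eq_abs] at h2
  have := norm_le_pi_norm a j
  linarith

theorem explicitLift_one (hA : ∀ j, (A j).IsHermitian) (hX : IsSmallSolution A b a X)
    (U : Fin n → ℂ) : explicitLift A b a X U 1 = ((0, 0), (0, fun j => (b j : ℂ) / 2)) := by
  have h1 : ∀ j, gForm (A j) (Kmat A X j) X 1 = 0 := fun j => gForm_one hX.2 (Kmat_eq A hX.2 j)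
  simp only [explicitLift, dilation_one hX.2, h1, hTildeForm_one hX.1 (pencil_middle_isHermitian hA),
    Matrix.one_mulVec, sub_self, Matrix.zero_mulVec, dotProduct_zero, Matrix.vecMul_zero,
    mul_one, one_pow, middle]
  refine Prod.ext rfl (Prod.ext rfl ?_)
  ext j
  simp only
  ring

/-- The values of `h̃` on the unit circle. -/
theorem explicitLift_hTilde (hA : ∀ j, (A j).IsHermitian) (hX : IsSmallSolution A b a X)
    (U : Fin n → ℂ) {ζ : ℂ} (hζ : ‖ζ‖ = 1) :
    (explicitLift A b a X U ζ).2.1 = -(ζ • (star (explicitLift A b a X U ζ).1.1 ᵥ*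
      pencil A (fun j => a j * conj ζ + middle b a j + conj (a j) * ζ))) := by
  have h1 : pencil A (fun j => a j * conj ζ + middle b a j + conj (a j) * ζ) =
      conj ζ • pencil A a + pencil A (middle b a) + ζ • (pencil A a)ᴴ := by
    rw [pencil_conjTranspose hA, ← pencil_smul, ← pencil_smul, ← pencil_add, ← pencil_add]
    congr 1
    ext j
    simp [mul_comm]
  have h2 : (explicitLift A b a X U ζ).1.1 = (1 - dilation X ζ) *ᵥ U := by
    simp [explicitLift, Matrix.sub_mulVec]
  rw [h1, h2, Matrix.star_mulVec, Matrix.vecMul_vecMul, ← Matrix.vecMul_smul, ← Matrix.vecMul_neg,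
    ← hTildeForm_eq hX.2 hX.1 (pencil_middle_isHermitian hA) hζ]
  rfl

theorem isStationaryLift_explicitLift (hA : ∀ j, (A j).IsHermitian) (hX : IsSmallSolution A b a X)
    (hb : ∃ j, 4 * ‖a‖ < |b j|) {U : Fin n → ℂ} (hU : U ≠ 0) :
    IsStationaryLift A (explicitLift A b a X U) where
  holo := by
    refine DifferentiableOn.diffContOnCl fun ζ hζ => ?_
    have hζ' : ‖ζ‖ ≤ 1 := by
      simpa using Metric.closure_ball_subset_closedBall hζ
    exact (hasDerivAt_explicitLift U (hasDerivAt_dilation hX.2 hζ')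
      (fun j => hasDerivAt_gForm _ _ hX.2 hζ' (hasDerivAt_dilation hX.2 hζ'))
      (hasDerivAt_hTildeForm ζ)).differentiableAt.differentiableWithinAt
  attached := by
    intro ζ hζ j
    have hζ' : ‖ζ‖ = 1 := by simpa using hζ
    have h2 : (explicitLift A b a X U ζ).1.1 = (1 - dilation X ζ) *ᵥ U := by
      simp [explicitLift, Matrix.sub_mulVec]
    have h3 := gForm_add_conjTranspose hX.2 (hA j) (Kmat_isHermitian hA X j) (Kmat_eq A hX.2 j) hζ'
    have h4 : (explicitLift A b a X U ζ).1.2 j =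
      star U ⬝ᵥ (gForm (A j) (Kmat A X j) X ζ *ᵥ U) := rfl
    rw [h2, star_mulVec_dotProduct_mulVec, h4, Complex.re_eq_add_conj, conj_star_dotProduct_mulVec,
      ← dotProduct_add, ← Matrix.add_mulVec, h3, Matrix.smul_mulVec, dotProduct_smul, smul_eq_mul]
    ring
  conormal := by
    choose c hc using exists_real_coeff b a
    refine ⟨c, fun ζ hζ => ?_⟩
    have hζ' : ‖ζ‖ = 1 := by simpa using hζ
    have hcζ : (fun j => (c ζ j : ℂ)) =
      fun j => a j * conj ζ + middle b a j + conj (a j) * ζ := funext (hc ζ)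
    simp only [sum_smul_delDefining, hcζ]
    constructor
    · obtain ⟨j, hj⟩ := hb
      intro h0
      have := congrFun (congrArg Prod.snd h0) j
      simp only [Prod.snd_zero, Pi.zero_apply, hc] at this
      exact coeff_ne_zero hj hζ' (by simpa using this)
    · refine Prod.ext ?_ ?_
      · rw [explicitLift_hTilde hA hX U hζ', Prod.smul_fst, smul_neg]
      · ext j
        have hζζ : conj ζ * ζ = 1 := by
          rw [mul_comm, Complex.mul_conj, Complex.normSq_eq_norm_sq, hζ']; simp
        simp only [explicitLift, Prod.smul_snd, Pi.smul_apply, smul_eq_mul, hc]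
        linear_combination (-(a j) / 2) * hζζ
  nonconstant := by
    refine ⟨0, by simp, 1, by simp, fun h => hU ?_⟩
    have h1 := congrArg Prod.fst h
    rw [explicitLift_one hA hX] at h1
    simpa [explicitLift, dilation] using h1

theorem hasExplicitForm_explicitLift (hA : ∀ j, (A j).IsHermitian)
    (hX : IsSmallSolution A b a (smallSolution A b a)) (U : Fin n → ℂ) :
    HasExplicitForm A b a U (explicitLift A b a (smallSolution A b a) U) where
  h_eq ζ _ := by simp [explicitLift, dilation, Matrix.smul_mulVec]
  g_eq ζ _ j := by
    simp only [explicitLift, gForm, dilation, Matrix.add_mulVec, Matrix.sub_mulVec, dotProduct_add,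
      dotProduct_sub, Matrix.smul_mulVec, dotProduct_smul, smul_eq_mul]
  hTilde_eq ζ hζ := explicitLift_hTilde hA hX U (by simpa using hζ)
  gTilde_eq _ _ _ := rfl

theorem ofReal_jetForm (hA : ∀ j, (A j).IsHermitian) (V : Fin n → ℂ) (j : Fin d) :
    (jetForm A b a V j : ℂ) = star ((1 - smallSolution A b a) *ᵥ V) ⬝ᵥ
      (Kmat A (smallSolution A b a) j *ᵥ ((1 - smallSolution A b a) *ᵥ V)) := by
  set X := smallSolution A b a with hXdef
  have h1 : (1 - X)ᴴ = 1 - Xᴴ := by simp [Matrix.conjTranspose_sub]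
  have h2 : ((1 - Xᴴ) * Kmat A X j * (1 - X)).IsHermitian := by
    rw [← h1]
    exact Matrix.isHermitian_conjTranspose_mul_mul _ (Kmat_isHermitian hA X j)
  rw [star_mulVec_dotProduct_mulVec, h1, jetForm]
  exact ofReal_re_of_isHermitian h2 V

/-- The lift with parameters `a` and `U = (1 - X) V` is a pointed stationary lift with the stated
`1`-jet at `1`. -/
theorem exists_explicit_lift (hA : ∀ j, (A j).IsHermitian)
    (hX : IsSmallSolution A b a (smallSolution A b a)) (hb : ∃ j, 4 * ‖a‖ < |b j|)
    {V : Fin n → ℂ} (hV : V ≠ 0) :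
    ∃ F ∈ pointedLifts A b, HasExplicitForm A b a ((1 - smallSolution A b a) *ᵥ V) F ∧
      HasDerivWithinAt F
        ((-V, fun j => -2 * (jetForm A b a V j : ℂ)),
          (-(star V ᵥ* pencil A (fun j => (b j : ℂ))),
            fun j => (b j : ℂ) / 2 - Complex.I * ((a j).im : ℂ)))
        (Metric.closedBall 0 1) 1 := by
  set X := smallSolution A b a with hXdef
  have hR := inv_mul_cancel_one_sub_smul hX.2 (ζ := 1) (by simp)
  rw [one_smul] at hR
  have hU : (1 - X) *ᵥ V ≠ 0 := fun h => hV <| by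
    rw [← Matrix.one_mulVec V, ← hR, ← Matrix.mulVec_mulVec, h, Matrix.mulVec_zero]
  have hmid := pencil_middle_isHermitian (b := b) (a := a) hA
  refine ⟨explicitLift A b a X ((1 - X) *ᵥ V), ⟨isStationaryLift_explicitLift hA hX hb hU,
    explicitLift_one hA hX _⟩, hasExplicitForm_explicitLift hA hX _, ?_⟩
  have h := hasDerivAt_explicitLift (A := A) (b := b) (a := a) ((1 - X) *ᵥ V)
    (hasDerivAt_dilation_one hX.2)
    (fun j => hasDerivAt_gForm_one hX.2 (Kmat_eq A hX.2 j)) (hasDerivAt_hTildeForm 1)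
  refine (h.congr_deriv ?_).hasDerivWithinAt
  refine Prod.ext (Prod.ext ?_ ?_) (Prod.ext ?_ ?_)
  · simp only [Matrix.mulVec_mulVec, hR, Matrix.one_mulVec]
  · ext j
    simp only [ofReal_jetForm hA, Matrix.neg_mulVec, Matrix.smul_mulVec, dotProduct_neg,
      dotProduct_smul, smul_eq_mul, neg_mul]
    rfl
  · simp only [Matrix.star_mulVec, Matrix.vecMul_vecMul, Matrix.conjTranspose_sub,
      Matrix.conjTranspose_one]
    rw [one_sub_mul_deriv_hTildeForm hX.1 hmid, Matrix.vecMul_neg, pencil_middle hA]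
    congr 2
    abel
  · ext j
    have : a j - conj (a j) = 2 * Complex.I * ((a j).im : ℂ) := by
      rw [Complex.sub_conj]; push_cast; ring
    simp only [middle]
    linear_combination (-1 / 2 : ℂ) * this

end ExplicitLift

/-! ### Stein and Sylvester equations -/

section Sylvester

variable {X : Matrix (Fin n) (Fin n) ℂ}

theorem mulVec_pow_tendsto_zero (hX : ‖X‖ < 1) (T : Matrix (Fin n) (Fin n) ℂ) (v : Fin n → ℂ) :
    Tendsto (fun r : ℕ => (T * X ^ r) *ᵥ v) atTop (𝓝 0) := by
  have h1 : Continuous fun M : Matrix (Fin n) (Fin n) ℂ => (T * M) *ᵥ v :=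
    Continuous.matrix_mulVec (continuous_const.mul continuous_id) continuous_const
  have h2 := (h1.tendsto 0).comp (tendsto_pow_atTop_nhds_zero_of_norm_lt_one hX)
  simpa [Function.comp_def] using h2

/-- If `T` vanishes on all `X ^ r v`, then it vanishes on all `X ^ r (1 - X)⁻¹ v`, because
`T X ^ r (1 - X)⁻¹ v` does not depend on `r` and tends to zero. -/
theorem mul_pow_mulVec_inv_eq_zero (hX : ‖X‖ < 1) {T : Matrix (Fin n) (Fin n) ℂ} {v : Fin n → ℂ}
    (h : ∀ r : ℕ, (T * X ^ r) *ᵥ v = 0) (r : ℕ) : (T * X ^ r) *ᵥ ((1 - X)⁻¹ *ᵥ v) = 0 := by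
  have hR := mul_inv_cancel_one_sub_smul hX (ζ := 1) (by simp)
  rw [one_smul] at hR
  set w := (1 - X)⁻¹ *ᵥ v
  have hw : v = w - X *ᵥ w := by
    have : (1 - X) *ᵥ w = v := by rw [Matrix.mulVec_mulVec, hR, Matrix.one_mulVec]
    rw [← this, Matrix.sub_mulVec, Matrix.one_mulVec]
  have hstep : ∀ r : ℕ, (T * X ^ (r + 1)) *ᵥ w = (T * X ^ r) *ᵥ w := by
    intro r
    have h1 := h r
    rw [hw, Matrix.mulVec_sub, Matrix.mulVec_mulVec w, mul_assoc, ← pow_succ, sub_eq_zero] at h1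
    exact h1.symm
  have hconst : ∀ r : ℕ, (T * X ^ r) *ᵥ w = (T * X ^ 0) *ᵥ w := by
    intro r
    induction r with
    | zero => rfl
    | succ r ih => rw [hstep, ih]
  have hlim := mulVec_pow_tendsto_zero hX T w
  simp only [hconst] at hlim
  rw [hconst]
  exact tendsto_nhds_unique tendsto_const_nhds hlim

/-- With `Y = (1 + X) (1 - X)⁻¹`, the Sylvester equation `Y Z + Z Y = 2 C` becomes the Stein
equation `κ = C + X κ X` for `κ = (1 - X)⁻¹ Z (1 - X)⁻¹`. -/
theorem stein_of_sylvester (hX : ‖X‖ < 1) {Z C : Matrix (Fin n) (Fin n) ℂ}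
    (h : (2 • (1 - X)⁻¹ - 1) * Z + Z * (2 • (1 - X)⁻¹ - 1) = 2 • C) :
    (1 - X)⁻¹ * Z * (1 - X)⁻¹ = C + X * ((1 - X)⁻¹ * Z * (1 - X)⁻¹) * X := by
  have h1 := inv_mul_cancel_one_sub_smul hX (ζ := 1) (by simp)
  have h2 := mul_inv_cancel_one_sub_smul hX (ζ := 1) (by simp)
  rw [one_smul] at h1 h2
  set R := (1 - X)⁻¹
  set κ := R * Z * R with hκ
  have hZ : Z = (1 - X) * κ * (1 - X) := by
    calc Z = ((1 - X) * R) * Z * (R * (1 - X)) := by rw [h1, h2, one_mul, mul_one]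
      _ = _ := by rw [hκ]; noncomm_ring
  have hY1 : (2 • R - 1) * (1 - X) = 1 + X := by
    rw [sub_mul, smul_mul_assoc, h1]; noncomm_ring
  have hY2 : (1 - X) * (2 • R - 1) = 1 + X := by
    rw [mul_sub, mul_smul_comm, h2]; noncomm_ring
  have h3 : 2 • (κ - X * κ * X) = 2 • C := by
    rw [← h]
    calc 2 • (κ - X * κ * X) = (1 + X) * κ * (1 - X) + (1 - X) * κ * (1 + X) := by noncomm_ring
      _ = ((2 • R - 1) * (1 - X)) * κ * (1 - X) + (1 - X) * κ * ((1 - X) * (2 • R - 1)) := by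
          rw [hY1, hY2]
      _ = (2 • R - 1) * ((1 - X) * κ * (1 - X)) + ((1 - X) * κ * (1 - X)) * (2 • R - 1) := by
          simp only [mul_assoc]
      _ = _ := by rw [← hZ]
  have h4 : κ - X * κ * X = C := by
    have := congrArg (fun Q => (1 / 2 : ℂ) • Q) h3
    simpa [← Nat.cast_smul_eq_nsmul ℂ, smul_smul] using this
  exact eq_add_of_sub_eq h4

theorem sylvester_unique (hX : ‖X‖ < 1) {Z : Matrix (Fin n) (Fin n) ℂ}
    (h : (2 • (1 - X)⁻¹ - 1) * Z + Z * (2 • (1 - X)⁻¹ - 1) = 0) : Z = 0 := by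
  have h1 := inv_mul_cancel_one_sub_smul hX (ζ := 1) (by simp)
  have h2 := mul_inv_cancel_one_sub_smul hX (ζ := 1) (by simp)
  rw [one_smul] at h1 h2
  have h3 := stein_of_sylvester hX (C := 0) (by rw [h]; simp)
  rw [zero_add] at h3
  have h4 : (1 - X)⁻¹ * Z * (1 - X)⁻¹ = 0 := by
    set κ := (1 - X)⁻¹ * Z * (1 - X)⁻¹
    have h5 : ‖κ‖ ≤ ‖X‖ ^ 2 * ‖κ‖ := by
      calc ‖κ‖ = ‖X * κ * X‖ := congrArg _ h3
        _ ≤ ‖X‖ * ‖κ‖ * ‖X‖ := norm_mul₃_le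
        _ = _ := by ring
    have h6 : ‖X‖ ^ 2 < 1 := pow_lt_one₀ (norm_nonneg _) hX two_ne_zero
    by_contra h7
    have : 0 < ‖κ‖ := norm_pos_iff.2 h7
    nlinarith
  calc Z = ((1 - X) * (1 - X)⁻¹) * Z * ((1 - X)⁻¹ * (1 - X)) := by rw [h1, h2, one_mul, mul_one]
    _ = (1 - X) * ((1 - X)⁻¹ * Z * (1 - X)⁻¹) * (1 - X) := by noncomm_ring
    _ = 0 := by rw [h4]; simp

/-- If `Y(s)² = 1 - 4 (M + s N)` and `Y L + L Y = 2 N` along a curve, then `Y' = -2 L`, and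
differentiating the second relation gives a Sylvester equation for `L'`. -/
theorem sylvester_deriv (hX : ‖X‖ < 1) {M N : Matrix (Fin n) (Fin n) ℂ}
    {Y L : ℝ → Matrix (Fin n) (Fin n) ℂ} {y l : Matrix (Fin n) (Fin n) ℂ}
    (hY0 : Y 0 = 2 • (1 - X)⁻¹ - 1) (hy : HasDerivAt Y y 0) (hl : HasDerivAt L l 0)
    (hYY : ∀ᶠ s in 𝓝 0, Y s * Y s = M - (4 * s) • N)
    (hYL : ∀ᶠ s in 𝓝 0, Y s * L s + L s * Y s = 2 • N) :
    Y 0 * l + l * Y 0 = 2 • (2 • (L 0 * L 0)) := by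
  have h1 : HasDerivAt (fun s => Y s * Y s) (-((4 : ℝ) • N)) 0 := by
    have : HasDerivAt (fun s : ℝ => M - (4 * s) • N) (-((4 : ℝ) • N)) 0 := by
      have := ((((hasDerivAt_id (0 : ℝ)).const_mul 4).smul_const N).const_sub M)
      exact this.congr_deriv (by rw [mul_one])
    exact this.congr_of_eventuallyEq hYY
  have h2 : y * Y 0 + Y 0 * y = -((4 : ℝ) • N) := (hy.mul hy).unique h1
  have h3 := hYL.self_of_nhds
  have h4 : y = -(2 • L 0) := by
    refine eq_neg_of_add_eq_zero_left (sylvester_unique hX ?_)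
    rw [← hY0]
    calc Y 0 * (y + 2 • L 0) + (y + 2 • L 0) * Y 0
        = (y * Y 0 + Y 0 * y) + 2 • (Y 0 * L 0 + L 0 * Y 0) := by noncomm_ring
      _ = 0 := by
        rw [h2, h3, smul_smul, ← Nat.cast_smul_eq_nsmul ℝ]; norm_num
  have h5 : HasDerivAt (fun s => Y s * L s + L s * Y s) 0 0 :=
    (hasDerivAt_const (0 : ℝ) (2 • N)).congr_of_eventuallyEq hYL
  have h6 : (y * L 0 + Y 0 * l) + (l * Y 0 + L 0 * y) = 0 :=
    ((hy.mul hl).add (hl.mul hy)).unique h5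
  rw [h4] at h6
  linear_combination (norm := noncomm_ring) h6

variable {B L κ : Matrix (Fin n) (Fin n) ℂ}

theorem stein_form_eq (hBX : B * X = Xᴴ * B) (hBL : B * L = Lᴴ * B)
    (hκ : κ = 2 • (L * L) + X * κ * X) (u : Fin n → ℂ) :
    star u ⬝ᵥ ((B * κ) *ᵥ u) = 2 * (star (L *ᵥ u) ⬝ᵥ (B *ᵥ (L *ᵥ u))) +
      star (X *ᵥ u) ⬝ᵥ ((B * κ) *ᵥ (X *ᵥ u)) := by
  have h : B * κ = (2 : ℂ) • (Lᴴ * B * L) + Xᴴ * (B * κ) * X := by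
    rw [← hBL, ← mul_assoc Xᴴ, ← hBX]
    nth_rewrite 1 [hκ]
    rw [two_smul ℂ, two_smul ℕ]
    noncomm_ring
  rw [star_mulVec_dotProduct_mulVec, star_mulVec_dotProduct_mulVec]
  nth_rewrite 1 [h]
  rw [Matrix.add_mulVec, dotProduct_add, Matrix.smul_mulVec, dotProduct_smul, smul_eq_mul]

theorem stein_form_nonneg (hX : ‖X‖ < 1) (hB : B.PosDef) (hBX : B * X = Xᴴ * B)
    (hBL : B * L = Lᴴ * B) (hκ : κ = 2 • (L * L) + X * κ * X) (u : Fin n → ℂ) :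
    0 ≤ (star u ⬝ᵥ ((B * κ) *ᵥ u)).re := by
  have hstep : ∀ r : ℕ, (star (X ^ r *ᵥ u) ⬝ᵥ ((B * κ) *ᵥ (X ^ r *ᵥ u))).re ≤
      (star u ⬝ᵥ ((B * κ) *ᵥ u)).re := by
    intro r
    induction r with
    | zero => simp
    | succ r ih =>
      refine le_trans ?_ ih
      rw [stein_form_eq hBX hBL hκ (X ^ r *ᵥ u), Matrix.mulVec_mulVec u X, ← pow_succ']
      have := (Complex.nonneg_iff.1 (hB.posSemidef.dotProduct_mulVec_nonneg (L *ᵥ (X ^ r *ᵥ u)))).1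
      rw [Complex.add_re, show (2 : ℂ) = ((2 : ℝ) : ℂ) by norm_num, Complex.re_ofReal_mul]
      linarith
  have hc : Continuous fun M : Matrix (Fin n) (Fin n) ℂ =>
      (star (M *ᵥ u) ⬝ᵥ ((B * κ) *ᵥ (M *ᵥ u))).re := by
    have h1 : Continuous fun M : Matrix (Fin n) (Fin n) ℂ => M *ᵥ u :=
      Continuous.matrix_mulVec continuous_id continuous_const
    exact Complex.continuous_re.comp (h1.star.dotProduct
      (Continuous.matrix_mulVec continuous_const h1))
  have h2 := (hc.tendsto 0).comp (tendsto_pow_atTop_nhds_zero_of_norm_lt_one hX)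
  simp only [Matrix.zero_mulVec, Matrix.mulVec_zero, dotProduct_zero, Complex.zero_re] at h2
  exact le_of_tendsto' h2 hstep

/-- The form `B κ` is the sum over `r` of the squared norms `2 ‖L X ^ r u‖²`; where it
vanishes, all of these vanish. -/
theorem stein_form_eq_zero (hX : ‖X‖ < 1) (hB : B.PosDef) (hBX : B * X = Xᴴ * B)
    (hBL : B * L = Lᴴ * B) (hκ : κ = 2 • (L * L) + X * κ * X) (r : ℕ) :
    ∀ u : Fin n → ℂ, (star u ⬝ᵥ ((B * κ) *ᵥ u)).re = 0 → (L * X ^ r) *ᵥ u = 0 := by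
  have hfirst : ∀ u : Fin n → ℂ, (star u ⬝ᵥ ((B * κ) *ᵥ u)).re = 0 →
      L *ᵥ u = 0 ∧ (star (X *ᵥ u) ⬝ᵥ ((B * κ) *ᵥ (X *ᵥ u))).re = 0 := by
    intro u hu
    have h1 := hB.posSemidef.dotProduct_mulVec_nonneg (L *ᵥ u)
    have h2 := stein_form_nonneg hX hB hBX hBL hκ (X *ᵥ u)
    rw [stein_form_eq hBX hBL hκ, Complex.add_re, show (2 : ℂ) = ((2 : ℝ) : ℂ) by norm_num,
      Complex.re_ofReal_mul] at hu
    obtain ⟨h3, h4⟩ := Complex.nonneg_iff.1 h1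
    refine ⟨eq_zero_of_dotProduct_mulVec_eq_zero hB (Complex.ext ?_ h4.symm), by linarith⟩
    rw [Complex.zero_re]
    linarith
  induction r with
  | zero => intro u hu; simpa using (hfirst u hu).1
  | succ r ih =>
    intro u hu
    rw [pow_succ, ← mul_assoc, ← Matrix.mulVec_mulVec]
    exact ih _ (hfirst u hu).2

end Sylvester

/-! ### The derivative of the forms `q_j` at real parameters -/

section RealDirections

/-- The real-linear family `t ↦ B⁻¹ ∑ t_j A_j`, where `B = ∑ b_j A_j`. -/
def relPencil (A : Fin d → Matrix (Fin n) (Fin n) ℂ) (b : Fin d → ℝ) :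
    (Fin d → ℝ) →ₗ[ℝ] Matrix (Fin n) (Fin n) ℂ :=
  LinearMap.mulLeft ℝ (pencil A (fun j => (b j : ℂ)))⁻¹ ∘ₗ Fintype.linearCombination ℝ A

variable {A : Fin d → Matrix (Fin n) (Fin n) ℂ} {b : Fin d → ℝ}

theorem pencil_ofReal (t : Fin d → ℝ) :
    pencil A (fun j => (t j : ℂ)) = Fintype.linearCombination ℝ A t := by
  simp only [pencil, Fintype.linearCombination_apply, Complex.coe_smul]

theorem relPencil_apply (t : Fin d → ℝ) :
    relPencil A b t = (pencil A (fun j => (b j : ℂ)))⁻¹ * pencil A (fun j => (t j : ℂ)) := by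
  rw [pencil_ofReal t]; rfl

theorem pencil_ofReal_isHermitian (hA : ∀ j, (A j).IsHermitian) (t : Fin d → ℝ) :
    (pencil A (fun j => (t j : ℂ))).IsHermitian := by
  rw [Matrix.IsHermitian, pencil_conjTranspose hA]
  simp only [Complex.conj_ofReal]

theorem eq_zero_of_relPencil_pow_eq_zero (hA : ∀ j, (A j).IsHermitian)
    (hB : (pencil A (fun j => (b j : ℂ))).PosDef) (hli : LinearIndependent ℝ A)
    (t : Fin d → ℝ) (k : ℕ) (h : relPencil A b t ^ k = 0) : t = 0 := by
  rw [relPencil_apply] at h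
  have h1 := eq_zero_of_inv_mul_pow_eq_zero hB (pencil_ofReal_isHermitian hA t) k h
  rw [pencil_ofReal, Fintype.linearCombination_apply] at h1
  exact funext (Fintype.linearIndependent_iff.1 hli t h1)

theorem mul_inv_of_posDef {B : Matrix (Fin n) (Fin n) ℂ} (hB : B.PosDef) : B * B⁻¹ = 1 :=
  Matrix.mul_nonsing_inv _ ((Matrix.isUnit_iff_isUnit_det _).1 hB.isUnit)

theorem inv_mul_of_posDef {B : Matrix (Fin n) (Fin n) ℂ} (hB : B.PosDef) : B⁻¹ * B = 1 :=
  Matrix.nonsing_inv_mul _ ((Matrix.isUnit_iff_isUnit_det _).1 hB.isUnit)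

section RealPoint

variable {a : Fin d → ℝ} {X : Matrix (Fin n) (Fin n) ℂ}

/-- At real parameters the quadratic equation reads `X = -M (1 - X)²` with `M = B⁻¹ P`. -/
theorem isSmallSolution_ofReal_iff (hA : ∀ j, (A j).IsHermitian)
    (hB : (pencil A (fun j => (b j : ℂ))).PosDef) :
    IsSmallSolution A b (fun j => (a j : ℂ)) X ↔
      X = -(relPencil A b a * ((1 - X) * (1 - X))) ∧ ‖X‖ < 1 := by
  rw [isSmallSolution_iff hA, (pencil_ofReal_isHermitian hA a).eq, relPencil_apply]
  set B := pencil A (fun j => (b j : ℂ))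
  set P := pencil A (fun j => (a j : ℂ))
  refine and_congr_left fun _ => ⟨fun h => ?_, fun h => ?_⟩
  · calc X = B⁻¹ * (B * X) := by rw [← mul_assoc, inv_mul_of_posDef hB, one_mul]
      _ = _ := by rw [h]; noncomm_ring
  · calc B * X = -((B * B⁻¹) * P * ((1 - X) * (1 - X))) := by
          nth_rewrite 1 [h]; noncomm_ring
      _ = _ := by rw [mul_inv_of_posDef hB]; noncomm_ring

theorem relPencil_eq (hA : ∀ j, (A j).IsHermitian)
    (hB : (pencil A (fun j => (b j : ℂ))).PosDef)
    (hX : IsSmallSolution A b (fun j => (a j : ℂ)) X) :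
    relPencil A b a = -(X * ((1 - X)⁻¹ * (1 - X)⁻¹)) := by
  obtain ⟨h1, h2⟩ := (isSmallSolution_ofReal_iff hA hB).1 hX
  have h3 := mul_inv_cancel_one_sub_smul h2 (ζ := 1) (by simp)
  rw [one_smul] at h3
  set R := (1 - X)⁻¹
  calc relPencil A b a = relPencil A b a * ((1 - X) * (((1 - X) * R) * R)) := by
        rw [h3, one_mul, h3, mul_one]
    _ = -(-(relPencil A b a * ((1 - X) * (1 - X))) * (R * R)) := by noncomm_ring
    _ = _ := by rw [← h1]

/-- At real parameters `X` is self-adjoint for the scalar product defined by `B`: its adjoint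
`B⁻¹ ᵗX̄ B` solves the same equation. -/
theorem mul_smallSolution_ofReal (hA : ∀ j, (A j).IsHermitian)
    (hB : (pencil A (fun j => (b j : ℂ))).PosDef)
    (hX : IsSmallSolution A b (fun j => (a j : ℂ)) X)
    (huniq : ∀ Y, IsSmallSolution A b (fun j => (a j : ℂ)) Y → Y = X)
    (hn : ‖(pencil A (fun j => (b j : ℂ)))⁻¹ * Xᴴ * pencil A (fun j => (b j : ℂ))‖ < 1) :
    pencil A (fun j => (b j : ℂ)) * X = Xᴴ * pencil A (fun j => (b j : ℂ)) := by
  have h0 := ((isSmallSolution_ofReal_iff hA hB).1 hX).1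
  have hM : relPencil A b a = (pencil A (fun j => (b j : ℂ)))⁻¹ * pencil A (fun j => (a j : ℂ)) :=
    relPencil_apply a
  have hPH := pencil_ofReal_isHermitian hA a
  have hBi := hB.inv.isHermitian
  have hB1 := mul_inv_of_posDef hB
  have hB2 := inv_mul_of_posDef hB
  set B := pencil A (fun j => (b j : ℂ)) with hBdef
  set P := pencil A (fun j => (a j : ℂ))
  set Z := B⁻¹ * Xᴴ * B with hZ
  have h1 : 1 - Z = B⁻¹ * (1 - Xᴴ) * B := by
    rw [hZ, mul_sub, sub_mul, mul_one, hB2]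
  have h2 : Z = -((1 - Z) * (1 - Z) * relPencil A b a) := by
    have h3 := congrArg Matrix.conjTranspose h0
    rw [hM] at h3
    simp only [Matrix.conjTranspose_neg, Matrix.conjTranspose_mul, Matrix.conjTranspose_sub,
      Matrix.conjTranspose_one, hPH.eq, hBi.eq] at h3
    rw [h1, hM]
    calc Z = B⁻¹ * (-((1 - Xᴴ) * (1 - Xᴴ) * (P * B⁻¹))) * B := by rw [← h3]
      _ = -(B⁻¹ * (1 - Xᴴ) * (1 - Xᴴ) * P * (B⁻¹ * B)) := by noncomm_ring
      _ = -(B⁻¹ * (1 - Xᴴ) * (B * B⁻¹) * (1 - Xᴴ) * (B * B⁻¹) * P) := by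
        rw [hB1, hB2]; simp only [mul_one]
      _ = _ := by simp only [mul_assoc]
  have h4 := mul_inv_cancel_one_sub_smul hn (ζ := 1) (by simp)
  have h5 := inv_mul_cancel_one_sub_smul hn (ζ := 1) (by simp)
  rw [one_smul] at h4 h5
  set R := (1 - Z)⁻¹
  -- `M` is a function of `Z`, hence commutes with `Z`.
  have hM2 : relPencil A b a = -(R * (R * Z)) := by
    calc relPencil A b a = (R * ((R * (1 - Z)) * (1 - Z))) * relPencil A b a := by
          rw [h5, one_mul, h5, one_mul]
      _ = -(R * (R * (-((1 - Z) * (1 - Z) * relPencil A b a)))) := by noncomm_ring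
      _ = _ := by rw [← h2]
  have hcomm : Z * (1 - Z) = (1 - Z) * Z := by noncomm_ring
  have h6 : Z = -(relPencil A b a * ((1 - Z) * (1 - Z))) := by
    rw [hM2]
    calc Z = R * ((R * (1 - Z)) * (1 - Z)) * Z := by rw [h5, one_mul, h5, one_mul]
      _ = R * R * ((1 - Z) * ((1 - Z) * Z)) := by simp only [mul_assoc]
      _ = R * R * (Z * (1 - Z) * (1 - Z)) := by rw [← hcomm, ← mul_assoc (1 - Z), ← hcomm]
      _ = _ := by noncomm_ring
  have h7 : Z = X := huniq Z ((isSmallSolution_ofReal_iff hA hB).2 ⟨h6, hn⟩)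
  calc B * X = (B * B⁻¹) * Xᴴ * B := by rw [← h7, hZ]; simp only [mul_assoc, ← hZ, h7]
    _ = Xᴴ * B := by rw [hB1, one_mul]

/-- The square of `Y = (1 + X) (1 - X)⁻¹` is `1 - 4 M`. -/
theorem cayley_sq (hA : ∀ j, (A j).IsHermitian)
    (hB : (pencil A (fun j => (b j : ℂ))).PosDef)
    (hX : IsSmallSolution A b (fun j => (a j : ℂ)) X) :
    (2 • (1 - X)⁻¹ - 1) * (2 • (1 - X)⁻¹ - 1) = 1 - (4 : ℝ) • relPencil A b a := by
  have h1 := mul_inv_cancel_one_sub_smul hX.2 (ζ := 1) (by simp)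
  rw [one_smul] at h1
  rw [relPencil_eq hA hB hX]
  set R := (1 - X)⁻¹
  have h2 : (4 : ℝ) • -(X * (R * R)) = 4 • -(X * (R * R)) := by
    rw [← Nat.cast_smul_eq_nsmul ℝ]; norm_num
  rw [h2]
  have h3 : R = R * R - X * (R * R) := by
    calc R = ((1 - X) * R) * R := by rw [h1, one_mul]
      _ = _ := by noncomm_ring
  linear_combination (norm := noncomm_ring) (-4 : Matrix (Fin n) (Fin n) ℂ) * h3

/-- `M = B⁻¹ P` is a function of `X`; so what vanishes on all `X ^ r V` vanishes on all
`M ^ m V`. -/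
theorem mul_relPencil_pow_mulVec_eq_zero (hA : ∀ j, (A j).IsHermitian)
    (hB : (pencil A (fun j => (b j : ℂ))).PosDef)
    (hX : IsSmallSolution A b (fun j => (a j : ℂ)) X) {T : Matrix (Fin n) (Fin n) ℂ} (m : ℕ) :
    ∀ V : Fin n → ℂ, (∀ r : ℕ, (T * X ^ r) *ᵥ V = 0) → (T * relPencil A b a ^ m) *ᵥ V = 0 := by
  induction m with
  | zero => intro V h; simpa using h 0
  | succ m ih =>
    intro V h
    rw [pow_succ, ← mul_assoc, ← Matrix.mulVec_mulVec]
    refine ih _ fun r => ?_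
    have h1 := mul_pow_mulVec_inv_eq_zero hX.2 (mul_pow_mulVec_inv_eq_zero hX.2 h) (r + 1)
    rw [relPencil_eq hA hB hX, Matrix.neg_mulVec, Matrix.mulVec_neg, Matrix.mulVec_mulVec,
      mul_assoc T, ← mul_assoc (X ^ r), ← pow_succ, neg_eq_zero]
    simpa only [Matrix.mulVec_mulVec, mul_assoc] using h1

end RealPoint

/-- The converse of `stein_of_sylvester`. -/
theorem sylvester_of_stein {X k N : Matrix (Fin n) (Fin n) ℂ} (hX : ‖X‖ < 1)
    (hk : k = N + X * k * X) :
    (2 • (1 - X)⁻¹ - 1) * ((1 - X) * k * (1 - X)) + ((1 - X) * k * (1 - X)) * (2 • (1 - X)⁻¹ - 1) =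
      2 • N := by
  have h1 := inv_mul_cancel_one_sub_smul hX (ζ := 1) (by simp)
  have h2 := mul_inv_cancel_one_sub_smul hX (ζ := 1) (by simp)
  rw [one_smul] at h1 h2
  set R := (1 - X)⁻¹
  have hY1 : (2 • R - 1) * (1 - X) = 1 + X := by
    rw [sub_mul, smul_mul_assoc, h1]; noncomm_ring
  have hY2 : (1 - X) * (2 • R - 1) = 1 + X := by
    rw [mul_sub, mul_smul_comm, h2]; noncomm_ring
  calc _ = ((2 • R - 1) * (1 - X)) * k * (1 - X) + (1 - X) * k * ((1 - X) * (2 • R - 1)) := by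
        simp only [mul_assoc]
    _ = 2 • (k - X * k * X) := by rw [hY1, hY2]; noncomm_ring
    _ = _ := by rw [sub_eq_of_eq_add hk]

/-- The combination `∑ t_j K_j`. -/
def Ksum (A : Fin d → Matrix (Fin n) (Fin n) ℂ) (t : Fin d → ℝ) (X : Matrix (Fin n) (Fin n) ℂ) :
    Matrix (Fin n) (Fin n) ℂ :=
  ∑ j, (t j : ℂ) • Kmat A X j

theorem Ksum_eq (t : Fin d → ℝ) {X : Matrix (Fin n) (Fin n) ℂ} (hX : ‖X‖ < 1) :
    Ksum A t X = pencil A (fun j => (t j : ℂ)) + Xᴴ * Ksum A t X * X := by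
  simp only [Ksum, pencil, Finset.mul_sum, Finset.sum_mul, ← Finset.sum_add_distrib]
  refine Finset.sum_congr rfl fun j _ => ?_
  nth_rewrite 1 [Kmat_eq A hX j]
  simp only [smul_add, mul_smul_comm, smul_mul_assoc]

theorem Ksum_isHermitian (hA : ∀ j, (A j).IsHermitian) (t : Fin d → ℝ)
    (X : Matrix (Fin n) (Fin n) ℂ) : (Ksum A t X).IsHermitian := by
  rw [Matrix.IsHermitian, Ksum, Matrix.conjTranspose_sum]
  refine Finset.sum_congr rfl fun j _ => ?_
  rw [Matrix.conjTranspose_smul, (Kmat_isHermitian hA X j).eq]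
  simp

theorem sum_mul_jetForm (t : Fin d → ℝ) (a : Fin d → ℂ) (V : Fin n → ℂ) :
    ∑ j, t j * jetForm A b a V j =
      (star V ⬝ᵥ (((1 - (smallSolution A b a)ᴴ) * Ksum A t (smallSolution A b a) *
        (1 - smallSolution A b a)) *ᵥ V)).re := by
  simp only [jetForm, Ksum, Finset.mul_sum, Finset.sum_mul, mul_smul_comm, smul_mul_assoc,
    Matrix.sum_mulVec, Matrix.smul_mulVec, dotProduct_sum, dotProduct_smul, smul_eq_mul,
    Complex.re_sum, Complex.re_ofReal_mul]

/-- The real-linear functional `Z ↦ Re (ᵗV̄ Z V)`. -/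
def reForm (V : Fin n → ℂ) : Matrix (Fin n) (Fin n) ℂ →L[ℝ] ℝ :=
  LinearMap.toContinuousLinearMap
    { toFun := fun Z => (star V ⬝ᵥ (Z *ᵥ V)).re
      map_add' := fun Z W => by rw [Matrix.add_mulVec, dotProduct_add, Complex.add_re]
      map_smul' := fun c Z => by
        rw [Matrix.smul_mulVec, dotProduct_smul, Complex.real_smul, Complex.re_ofReal_mul]
        rfl }

theorem contDiffAt_inv_one_sub {X : Matrix (Fin n) (Fin n) ℂ} (hX : ‖X‖ < 1) :
    ContDiffAt ℝ ω (fun Y : Matrix (Fin n) (Fin n) ℂ => (1 - Y)⁻¹) X := by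
  have hu : IsUnit (1 - X) := by simpa using isUnit_one_sub_smul hX (ζ := 1) (by simp)
  have h := contDiffAt_ringInverse ℝ (n := ω) (R := Matrix (Fin n) (Fin n) ℂ) hu.unit
  rw [hu.unit_spec] at h
  simp only [Matrix.nonsing_inv_eq_ringInverse]
  exact ContDiffAt.comp X h (contDiff_const.sub contDiff_id).contDiffAt

/-- The derivative of `∑ t_j q_j` in the real direction `t` at a real point is a sum of squares
`2 ∑ ‖L X ^ r (1 - X) V‖²` in the norm defined by `B`. If it vanishes, so does `B⁻¹ ∑ t_j A_j` on
the Krylov space of `V`. -/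
theorem relPencil_mul_pow_mulVec_eq_zero (hA : ∀ j, (A j).IsHermitian)
    (hB : (pencil A (fun j => (b j : ℂ))).PosDef) {a : Fin d → ℝ}
    (hdiff : ContDiffAt ℝ ω (smallSolution A b) (fun j => (a j : ℂ)))
    (hsol : ∀ᶠ a' in 𝓝 (fun j => (a j : ℂ)),
      (∀ X, IsSmallSolution A b a' X ↔ X = smallSolution A b a') ∧
      ‖(pencil A (fun j => (b j : ℂ)))⁻¹ * (smallSolution A b a')ᴴ *
        pencil A (fun j => (b j : ℂ))‖ < 1)
    (t : Fin d → ℝ) (V : Fin n → ℂ)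
    (hder : HasDerivAt (fun s : ℝ => ∑ j, t j *
      jetForm A b (fun j => (((a + s • t) j : ℝ) : ℂ)) V j) 0 0) (m : ℕ) :
    (relPencil A b t * relPencil A b a ^ m) *ᵥ V = 0 := by
  have hB1 := mul_inv_of_posDef hB
  have hB2 := inv_mul_of_posDef hB
  have hrel : ∀ t, relPencil A b t =
    (pencil A (fun j => (b j : ℂ)))⁻¹ * pencil A (fun j => (t j : ℂ)) := relPencil_apply
  let c : ℝ → Fin d → ℂ := fun s j => (((a + s • t) j : ℝ) : ℂ)
  have hc0 : c 0 = fun j => (a j : ℂ) := by simp [c]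
  have hcd : Differentiable ℝ c := by
    refine differentiable_pi.2 fun j => ?_
    simp only [c, Pi.add_apply, Pi.smul_apply, smul_eq_mul]
    exact Complex.ofRealCLM.differentiable.comp ((differentiable_id.mul_const _).const_add _)
  rw [← hc0] at hdiff hsol
  have hsolc := hcd.continuous.continuousAt.eventually hsol
  set B := pencil A (fun j => (b j : ℂ)) with hBdef
  let X : ℝ → Matrix (Fin n) (Fin n) ℂ := fun s => smallSolution A b (c s)
  have hXs : ∀ᶠ s in 𝓝 0, IsSmallSolution A b (c s) (X s) ∧ B * X s = (X s)ᴴ * B := by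
    filter_upwards [hsolc] with s hs
    have h1 : IsSmallSolution A b (c s) (X s) := (hs.1 _).2 rfl
    exact ⟨h1, mul_smallSolution_ofReal hA hB h1 (fun Y hY => (hs.1 Y).1 hY) hs.2⟩
  obtain ⟨hX0, hBX0⟩ := hXs.self_of_nhds
  have hX0n : ‖X 0‖ < 1 := hX0.2
  have hXd : DifferentiableAt ℝ X 0 :=
    (hdiff.differentiableAt (by simp)).comp 0 hcd.differentiableAt
  let k : ℝ → Matrix (Fin n) (Fin n) ℂ := fun s => B⁻¹ * Ksum A t (X s)
  have hkd : DifferentiableAt ℝ k 0 := by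
    have h1 : DifferentiableAt ℝ (Ksum A t) (X 0) := by
      unfold Ksum
      exact DifferentiableAt.fun_sum fun j _ =>
        ((contDiffAt_Kmat A hX0n j).differentiableAt (by simp)).const_smul (t j : ℂ)
    exact (h1.comp 0 hXd).const_mul B⁻¹
  let L : ℝ → Matrix (Fin n) (Fin n) ℂ := fun s => (1 - X s) * k s * (1 - X s)
  let Y : ℝ → Matrix (Fin n) (Fin n) ℂ := fun s => 2 • (1 - X s)⁻¹ - 1
  have hLd : DifferentiableAt ℝ L 0 := ((hXd.const_sub 1).mul hkd).mul (hXd.const_sub 1)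
  have hYd : DifferentiableAt ℝ Y 0 :=
    ((((contDiffAt_inv_one_sub hX0n).differentiableAt (by simp)).comp 0 hXd).const_smul 2).sub_const
      1
  have hBL : ∀ s, B * X s = (X s)ᴴ * B →
      B * L s = (1 - (X s)ᴴ) * Ksum A t (X s) * (1 - X s) := by
    intro s hs
    calc B * L s = (B - B * X s) * B⁻¹ * Ksum A t (X s) * (1 - X s) := by
          simp only [L, k]; noncomm_ring
      _ = (1 - (X s)ᴴ) * (B * B⁻¹) * Ksum A t (X s) * (1 - X s) := by rw [hs]; noncomm_ring
      _ = _ := by rw [hB1, mul_one]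
  have hstein : ∀ s, IsSmallSolution A b (c s) (X s) → B * X s = (X s)ᴴ * B →
      k s = relPencil A b t + X s * k s * X s := by
    intro s h1 h2
    have h3 : B⁻¹ * (X s)ᴴ = X s * B⁻¹ := by
      calc B⁻¹ * (X s)ᴴ = B⁻¹ * ((X s)ᴴ * B) * B⁻¹ := by
            rw [mul_assoc, mul_assoc, hB1, mul_one]
        _ = _ := by rw [← h2, ← mul_assoc, hB2, one_mul]
    calc k s = B⁻¹ * (pencil A (fun j => (t j : ℂ)) + (X s)ᴴ * Ksum A t (X s) * X s) := by
          rw [← Ksum_eq t h1.2]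
      _ = B⁻¹ * pencil A (fun j => (t j : ℂ)) + B⁻¹ * (X s)ᴴ * Ksum A t (X s) * X s := by
          noncomm_ring
      _ = _ := by rw [h3, hrel]; simp only [k, mul_assoc]
  have hYY : ∀ᶠ s in 𝓝 0, Y s * Y s =
      (1 - (4 : ℝ) • relPencil A b a) - (4 * s) • relPencil A b t := by
    filter_upwards [hXs] with s hs
    have h1 := cayley_sq (a := a + s • t) hA hB hs.1
    rw [map_add, map_smul, smul_add, smul_smul, ← sub_sub] at h1
    exact h1
  have hYL : ∀ᶠ s in 𝓝 0, Y s * L s + L s * Y s = 2 • relPencil A b t := by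
    filter_upwards [hXs] with s hs
    exact sylvester_of_stein hs.1.2 (hstein s hs.1 hs.2)
  have hsyl := sylvester_deriv hX0n rfl hYd.hasDerivAt hLd.hasDerivAt hYY hYL
  -- The derivative of `L` is `(1 - X) κ (1 - X)` with `κ = 2 L² + X κ X`.
  have hκ := stein_of_sylvester hX0n hsyl
  set R := (1 - X 0)⁻¹ with hR
  have hR1 : (1 - X 0) * R = 1 := by
    simpa using mul_inv_cancel_one_sub_smul hX0n (ζ := 1) (by simp)
  have hR2 : R * (1 - X 0) = 1 := by
    simpa using inv_mul_cancel_one_sub_smul hX0n (ζ := 1) (by simp)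
  set κ := R * deriv L 0 * R with hκdef
  have hL' : B * deriv L 0 = (1 - X 0)ᴴ * (B * κ) * (1 - X 0) := by
    have h1 : (1 - X 0)ᴴ * B = B * (1 - X 0) := by
      rw [Matrix.conjTranspose_sub, Matrix.conjTranspose_one, sub_mul, mul_sub, hBX0, one_mul,
        mul_one]
    calc B * deriv L 0 = B * (((1 - X 0) * R) * deriv L 0 * (R * (1 - X 0))) := by
          rw [hR1, hR2, one_mul, mul_one]
      _ = B * (1 - X 0) * κ * (1 - X 0) := by rw [hκdef]; simp only [mul_assoc]
      _ = _ := by rw [← h1]; simp only [mul_assoc]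
  have hq : HasDerivAt (fun s : ℝ => reForm V (B * L s)) (reForm V (B * deriv L 0)) 0 :=
    (reForm V).hasFDerivAt.comp_hasDerivAt 0 (hLd.hasDerivAt.const_mul B)
  have hq0 : reForm V (B * deriv L 0) = 0 := by
    refine hq.unique (hder.congr_of_eventuallyEq ?_)
    filter_upwards [hXs] with s hs
    rw [sum_mul_jetForm, hBL s hs.2]
    rfl
  have hform : (star ((1 - X 0) *ᵥ V) ⬝ᵥ ((B * κ) *ᵥ ((1 - X 0) *ᵥ V))).re = 0 := by
    rw [star_mulVec_dotProduct_mulVec, ← hL']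
    exact hq0
  have hLH : B * L 0 = (L 0)ᴴ * B := by
    have h1 : (B * L 0).IsHermitian := by
      rw [hBL 0 hBX0, ← Matrix.conjTranspose_one, ← Matrix.conjTranspose_sub,
        Matrix.conjTranspose_one]
      exact Matrix.isHermitian_conjTranspose_mul_mul _ (Ksum_isHermitian hA t _)
    have h2 := h1.eq
    rw [Matrix.conjTranspose_mul, hB.isHermitian.eq] at h2
    exact h2.symm
  have hLU : ∀ r : ℕ, (L 0 * X 0 ^ r) *ᵥ ((1 - X 0) *ᵥ V) = 0 := fun r =>
    stein_form_eq_zero hX0n hB hBX0 hLH hκ r _ hform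
  have hLV : ∀ r : ℕ, (L 0 * X 0 ^ r) *ᵥ V = 0 := by
    intro r
    have h1 := mul_pow_mulVec_inv_eq_zero hX0n hLU r
    rwa [Matrix.mulVec_mulVec V, ← hR, hR2, Matrix.one_mulVec] at h1
  have hLRV := mul_pow_mulVec_inv_eq_zero hX0n hLV
  -- `N = k - X k X` with `k = R L R`, so `N` vanishes where `L R` does.
  have hN : relPencil A b t = R * L 0 * R - X 0 * R * L 0 * R * X 0 := by
    have h1 : R * L 0 * R = k 0 := by
      calc R * L 0 * R = (R * (1 - X 0)) * k 0 * ((1 - X 0) * R) := by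
            simp only [L, mul_assoc]
        _ = _ := by rw [hR1, hR2, one_mul, mul_one]
    rw [mul_assoc (X 0) R, mul_assoc (X 0), h1]
    exact eq_sub_of_add_eq (hstein 0 hX0 hBX0).symm
  have hcomm : ∀ r : ℕ, R * X 0 ^ r = X 0 ^ r * R := by
    intro r
    have h1 : Commute (1 - X 0) (X 0 ^ r) :=
      ((Commute.one_left _).sub_left (Commute.refl _)).pow_right r
    calc R * X 0 ^ r = R * (X 0 ^ r * (1 - X 0)) * R := by
          rw [mul_assoc, mul_assoc, hR1, mul_one]
      _ = _ := by rw [← h1.eq, ← mul_assoc, hR2, one_mul]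
  have hNV : ∀ r : ℕ, (relPencil A b t * X 0 ^ r) *ᵥ V = 0 := by
    intro r
    have h1 : relPencil A b t * X 0 ^ r = R * (L 0 * X 0 ^ r * R) -
        X 0 * R * (L 0 * X 0 ^ (r + 1) * R) := by
      rw [hN, sub_mul, mul_assoc _ (X 0) (X 0 ^ r), ← pow_succ', mul_assoc _ R, hcomm,
        mul_assoc _ R, hcomm]
      simp only [mul_assoc]
    rw [h1, Matrix.sub_mulVec, ← Matrix.mulVec_mulVec, ← Matrix.mulVec_mulVec,
      ← Matrix.mulVec_mulVec V, ← Matrix.mulVec_mulVec V, hLRV, hLRV, Matrix.mulVec_zero,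
      Matrix.mulVec_zero, sub_zero]
  refine mul_relPencil_pow_mulVec_eq_zero hA hB ?_ m V hNV
  rw [← hc0]
  exact hX0

end RealDirections

/-! ### The `1`-jet map as a local diffeomorphism -/

section JetMap

variable {A : Fin d → Matrix (Fin n) (Fin n) ℂ} {b : Fin d → ℝ}

theorem contDiffAt_jetForm {a : Fin d → ℂ} (hdiff : ContDiffAt ℝ ω (smallSolution A b) a)
    (hn : ‖smallSolution A b a‖ < 1) (V : Fin n → ℂ) (j : Fin d) :
    ContDiffAt ℝ ω (fun p : (Fin d → ℂ) × (Fin n → ℂ) => jetForm A b p.1 p.2 j) (a, V) := by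
  let G : (Fin d → ℂ) → Matrix (Fin n) (Fin n) ℂ := fun a =>
    (1 - (smallSolution A b a)ᴴ) * Kmat A (smallSolution A b a) j * (1 - smallSolution A b a)
  have hG : ContDiffAt ℝ ω G a := by
    have h1 : ContDiffAt ℝ ω (fun a => (smallSolution A b a)ᴴ) a :=
      contDiff_conjTranspose.contDiffAt.comp a hdiff
    have h2 : ContDiffAt ℝ ω (fun a => Kmat A (smallSolution A b a) j) a :=
      (contDiffAt_Kmat A hn j).comp a hdiff
    exact ((contDiffAt_const.sub h1).mul h2).mul (contDiffAt_const.sub hdiff)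
  have hGe : ∀ i k, ContDiffAt ℝ ω (fun p : (Fin d → ℂ) × (Fin n → ℂ) => G p.1 i k) (a, V) := by
    intro i k
    let e : Matrix (Fin n) (Fin n) ℂ →L[ℝ] ℂ :=
      LinearMap.toContinuousLinearMap (Matrix.entryLinearMap ℝ ℂ i k)
    exact e.contDiff.contDiffAt.comp (a, V) (hG.comp (a, V) contDiffAt_fst)
  have hV : ∀ i, ContDiff ℝ ω (fun p : (Fin d → ℂ) × (Fin n → ℂ) => p.2 i) := fun i =>
    (contDiff_apply ℝ ℂ i).comp contDiff_snd
  have hVc : ∀ i, ContDiff ℝ ω (fun p : (Fin d → ℂ) × (Fin n → ℂ) => star (p.2 i)) := fun i =>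
    Complex.conjCLE.contDiff.comp (hV i)
  have hsum : ContDiffAt ℝ ω (fun p : (Fin d → ℂ) × (Fin n → ℂ) =>
      ∑ i, star (p.2 i) * ∑ k, G p.1 i k * p.2 k) (a, V) :=
    ContDiffAt.sum fun i _ => (hVc i).contDiffAt.mul
      (ContDiffAt.sum fun k _ => (hGe i k).mul (hV k).contDiffAt)
  exact Complex.reCLM.contDiff.contDiffAt.comp (a, V) hsum

theorem contDiffAt_oneJetMap {a : Fin d → ℂ} (hdiff : ContDiffAt ℝ ω (smallSolution A b) a)
    (hn : ‖smallSolution A b a‖ < 1) (V : Fin n → ℂ) :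
    ContDiffAt ℝ ω (oneJetMap A b) (a, V) := by
  have him : ∀ j, ContDiff ℝ ω (fun p : (Fin d → ℂ) × (Fin n → ℂ) => (p.1 j).im) := fun j =>
    Complex.imCLM.contDiff.comp ((contDiff_apply ℝ ℂ j).comp contDiff_fst)
  exact contDiffAt_snd.prodMk (ContDiffAt.prodMk (contDiffAt_pi.2 fun j =>
    contDiffAt_jetForm hdiff hn V j) (contDiffAt_pi.2 fun j => (him j).contDiffAt))

/-- The `1`-jet map is a local diffeomorphism at `(a, V)`, `a` real and small, if no nonzero
real combination of the matrices `B⁻¹ A_j` vanishes on the Krylov space of `B⁻¹ P` and `V`. -/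
theorem isLocalDiffeomorphAt_oneJetMap (hA : ∀ j, (A j).IsHermitian)
    (hB : (pencil A (fun j => (b j : ℂ))).PosDef) {a : Fin d → ℝ}
    (hdiff : ContDiffAt ℝ ω (smallSolution A b) (fun j => (a j : ℂ)))
    (hsol : ∀ᶠ a' in 𝓝 (fun j => (a j : ℂ)),
      (∀ X, IsSmallSolution A b a' X ↔ X = smallSolution A b a') ∧
      ‖(pencil A (fun j => (b j : ℂ)))⁻¹ * (smallSolution A b a')ᴴ *
        pencil A (fun j => (b j : ℂ))‖ < 1) {V : Fin n → ℂ}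
    (hV : ∀ t, (∀ m : ℕ, (relPencil A b t * relPencil A b a ^ m) *ᵥ V = 0) → t = 0) :
    IsLocalDiffeomorphAt 𝓘(ℝ, (Fin d → ℂ) × (Fin n → ℂ))
      𝓘(ℝ, (Fin n → ℂ) × (Fin d → ℝ) × (Fin d → ℝ)) ∞
      (oneJetMap A b) ((fun j => (a j : ℂ)), V) := by
  have hn : ‖smallSolution A b (fun j => (a j : ℂ))‖ < 1 := ((hsol.self_of_nhds.1 _).2 rfl).2
  have hcd := contDiffAt_oneJetMap hdiff hn V
  have hfd := (hcd.differentiableAt (by simp)).hasFDerivAt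
  refine isLocalDiffeomorphAt_of_injective_fderiv ?_ hcd ?_
  · simp [Module.finrank_pi_fintype]
    ring
  rintro ⟨τ, v⟩ hv
  have hline : HasDerivAt (fun s : ℝ => (((fun j => (a j : ℂ)), V) : (Fin d → ℂ) × (Fin n → ℂ)) +
      s • (τ, v)) (τ, v) 0 := by
    simpa using ((hasDerivAt_id (0 : ℝ)).smul_const (τ, v)).const_add
      (((fun j => (a j : ℂ)), V) : (Fin d → ℂ) × (Fin n → ℂ))
  have hcurve : HasDerivAt (fun s : ℝ => oneJetMap A b
      ((((fun j => (a j : ℂ)), V) : (Fin d → ℂ) × (Fin n → ℂ)) + s • (τ, v))) 0 0 := by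
    rw [← hv]
    have hfd' : HasFDerivAt (oneJetMap A b) (fderiv ℝ (oneJetMap A b) (fun j => (a j : ℂ), V))
        ((((fun j => (a j : ℂ)), V) : (Fin d → ℂ) × (Fin n → ℂ)) + (0 : ℝ) • (τ, v)) := by
      simpa using hfd
    exact hfd'.comp_hasDerivAt (0 : ℝ) hline
  -- The components `V` and `Im a` of the jet map have injective derivative in `v` and `Im τ`.
  have hv0 : v = 0 := by
    have h1 := (hasFDerivAt_fst (𝕜 := ℝ)).comp_hasDerivAt (0 : ℝ) hcurve
    have h2 := (hasFDerivAt_snd (𝕜 := ℝ)).comp_hasDerivAt (0 : ℝ) hline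
    exact h2.unique h1
  have him : ∀ j, (τ j).im = 0 := by
    intro j
    have h1 := hasDerivAt_pi.1 ((hasFDerivAt_snd (𝕜 := ℝ)).comp_hasDerivAt (0 : ℝ)
      ((hasFDerivAt_snd (𝕜 := ℝ)).comp_hasDerivAt (0 : ℝ) hcurve)) j
    have h2 := Complex.imCLM.hasFDerivAt.comp_hasDerivAt (0 : ℝ)
      (hasDerivAt_pi.1 ((hasFDerivAt_fst (𝕜 := ℝ)).comp_hasDerivAt (0 : ℝ) hline) j)
    exact h2.unique h1
  have hτ : τ = fun j => ((τ j).re : ℂ) := by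
    ext j
    exact Complex.ext rfl (by simp [him j])
  have hτ0 : (fun j => (τ j).re) = 0 := by
    refine hV _ fun m => relPencil_mul_pow_mulVec_eq_zero hA hB hdiff hsol _ V ?_ m
    have h1 : ∀ j, HasDerivAt (fun s : ℝ => jetForm A b
        (fun j => (((a + s • fun j => (τ j).re) j : ℝ) : ℂ)) V j) 0 0 := by
      intro j
      have h2 := hasDerivAt_pi.1 ((hasFDerivAt_fst (𝕜 := ℝ)).comp_hasDerivAt (0 : ℝ)
        ((hasFDerivAt_snd (𝕜 := ℝ)).comp_hasDerivAt (0 : ℝ) hcurve)) j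
      refine h2.congr_of_eventuallyEq (Eventually.of_forall fun s => ?_)
      have h3 : (fun j => (((a + s • fun j => (τ j).re) j : ℝ) : ℂ)) =
          (fun j => (a j : ℂ)) + s • τ := by
        rw [hτ]; ext j; simp
      refine (congrArg (fun x => jetForm A b x V j) h3).trans ?_
      simp [oneJetMap, hv0]
    simpa using HasDerivAt.fun_sum fun j (_ : j ∈ Finset.univ) => (h1 j).const_mul (τ j).re
  rw [hv0, hτ]
  refine Prod.ext ?_ rfl
  ext j
  simpa using congrFun hτ0 j

/-- For small `a` the matrix `X` is well defined and the explicit lifts exist. -/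
theorem exists_radius_explicit_lifts (hA : ∀ j, (A j).IsHermitian)
    (hB : (pencil A (fun j => (b j : ℂ))).PosDef) :
    ∃ ρ > 0, ∀ a : Fin d → ℂ, ‖a‖ < ρ → (∃! X, IsSmallSolution A b a X) ∧
      ∀ V : Fin n → ℂ, V ≠ 0 → ∃ F ∈ pointedLifts A b,
        HasExplicitForm A b a ((1 - smallSolution A b a) *ᵥ V) F ∧
        HasDerivWithinAt F
          ((-V, fun j => -2 * (jetForm A b a V j : ℂ)),
            (-(star V ᵥ* pencil A (fun j => (b j : ℂ))),
              fun j => (b j : ℂ) / 2 - Complex.I * ((a j).im : ℂ)))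
          (Metric.closedBall 0 1) 1 := by
  obtain ⟨-, -, hsol⟩ := smallSolution_spec hA hB
  have hb : ∀ᶠ a : Fin d → ℂ in 𝓝 0, ∀ j, b j ≠ 0 → 4 * ‖a‖ < |b j| := by
    refine eventually_all.2 fun j => ?_
    by_cases hj : b j = 0
    · exact Eventually.of_forall fun a h => (h hj).elim
    · have hc : Continuous fun a : Fin d → ℂ => 4 * ‖a‖ := continuous_const.mul continuous_norm
      filter_upwards [hc.continuousAt.eventually_lt_const (u := |b j|) (by simpa using hj)]
        with a ha _ using ha
  obtain ⟨ρ, hρ, h⟩ := Metric.eventually_nhds_iff_ball.1 (hsol.and hb)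
  refine ⟨ρ, hρ, fun a ha => ?_⟩
  obtain ⟨h1, h2⟩ := h a (by simpa using ha)
  refine ⟨⟨_, (h1 _).2 rfl, fun Y hY => (h1 Y).1 hY⟩, fun V hV => ?_⟩
  refine exists_explicit_lift hA ((h1 _).2 rfl) ?_ hV
  -- `b ≠ 0`, because the form `B` is positive definite on a nonzero space.
  by_contra! hb0
  have hbz : ∀ j, b j = 0 := fun j => by
    by_contra hj
    exact absurd (h2 j hj) (not_lt.2 (hb0 j))
  refine hV (eq_zero_of_dotProduct_mulVec_eq_zero hB ?_)
  simp [pencil, hbz]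

theorem exists_isLocalDiffeomorphAt_oneJetMap (hA : ∀ j, (A j).IsHermitian)
    (hB : (pencil A (fun j => (b j : ℂ))).PosDef) (hli : LinearIndependent ℝ A) :
    ∀ ε > 0, ∃ (a : Fin d → ℝ) (V : Fin n → ℂ), ‖a‖ < ε ∧
      IsLocalDiffeomorphAt 𝓘(ℝ, (Fin d → ℂ) × (Fin n → ℂ))
        𝓘(ℝ, (Fin n → ℂ) × (Fin d → ℝ) × (Fin d → ℝ)) ∞
        (oneJetMap A b) ((fun j => (a j : ℂ)), V) := by
  obtain ⟨hdiff, hX0, hsol⟩ := smallSolution_spec hA hB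
  intro ε hε
  have hnorm : ∀ᶠ a in 𝓝 0, ‖(pencil A (fun j => (b j : ℂ)))⁻¹ *
      (smallSolution A b a)ᴴ * pencil A (fun j => (b j : ℂ))‖ < 1 := by
    have h1 : ContinuousAt (fun a => ‖(pencil A (fun j => (b j : ℂ)))⁻¹ *
        (smallSolution A b a)ᴴ *
          pencil A (fun j => (b j : ℂ))‖) 0 :=
      ((continuousAt_const.mul (contDiff_conjTranspose.continuous.continuousAt.comp
        hdiff.continuousAt)).mul continuousAt_const).norm
    exact h1.eventually_lt_const (by simp [hX0])
  obtain ⟨δ, hδ, h⟩ := Metric.eventually_nhds_iff_ball.1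
    (((hsol.and hnorm).eventually_nhds).and (hdiff.eventually (by simp)))
  obtain ⟨a, V, hV⟩ := exists_krylov_separating (relPencil A b)
    (eq_zero_of_relPencil_pow_eq_zero hA hB hli)
  -- The Krylov condition is invariant under scaling of `a`.
  obtain ⟨c, hc, hca⟩ : ∃ c : ℝ, 0 < c ∧ ‖c • a‖ < min ε δ := by
    have h1 : ContinuousAt (fun c : ℝ => ‖c • a‖) 0 := by fun_prop
    have h2 := h1.eventually_lt_const (u := min ε δ) (by simpa using ⟨hε, hδ⟩)
    obtain ⟨c, h3, h4⟩ := ((h2.filter_mono nhdsWithin_le_nhds).and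
      (self_mem_nhdsWithin : Set.Ioi (0 : ℝ) ∈ 𝓝[>] 0)).exists
    exact ⟨c, h4, h3⟩
  refine ⟨c • a, V, hca.trans_le (min_le_left _ _), ?_⟩
  have hball : (fun j => (((c • a) j : ℝ) : ℂ)) ∈ Metric.ball (0 : Fin d → ℂ) δ := by
    rw [mem_ball_zero_iff, pi_norm_lt_iff hδ]
    intro j
    rw [Complex.norm_real]
    exact (norm_le_pi_norm (c • a) j).trans_lt (hca.trans_le (min_le_right _ _))
  obtain ⟨h1, h2⟩ := h _ hball
  refine isLocalDiffeomorphAt_oneJetMap hA hB h2 h1 fun t ht => hV t fun m => ?_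
  have h3 := ht m
  rw [map_smul, smul_pow, mul_smul_comm, Matrix.smul_mulVec] at h3
  exact (smul_eq_zero.1 h3).resolve_left (pow_ne_zero _ hc.ne')

end JetMap

end StationaryJet

end

theorem mainTheorem2 {n d : ℕ} (A : Fin d → Matrix (Fin n) (Fin n) ℂ)
    (hA : ∀ j, (A j).IsHermitian)
    (hpsc : StationaryJet.StronglyPseudoconvex A)
    (hli : LinearIndependent ℝ A) :
    ∀ b : Fin d → ℝ, (StationaryJet.pencil A (fun j => (b j : ℂ))).PosDef →
      -- for small `a` the matrix `X` is well defined, and the map `oneJetMap` is the `1`-jet at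
      -- `ζ = 1` of the explicit family of lifts of stationary discs
      (∃ ρ > 0, ∀ a : Fin d → ℂ, ‖a‖ < ρ →
        (∃! X, StationaryJet.IsSmallSolution A b a X) ∧
        ∀ V : Fin n → ℂ, V ≠ 0 → ∃ F ∈ StationaryJet.pointedLifts A b,
          StationaryJet.HasExplicitForm A b a ((1 - StationaryJet.smallSolution A b a) *ᵥ V) F ∧
          HasDerivWithinAt F
            ((-V, fun j => -2 * (StationaryJet.jetForm A b a V j : ℂ)),
              (-(star V ᵥ* StationaryJet.pencil A (fun j => (b j : ℂ))),
                fun j => (b j : ℂ) / 2 - Complex.I * ((a j).im : ℂ)))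
            (Metric.closedBall 0 1) 1) ∧
      -- the `1`-jet map is a local diffeomorphism at some `(a, V)` with `a` real
      ∀ ε > 0, ∃ (a : Fin d → ℝ) (V : Fin n → ℂ), ‖a‖ < ε ∧
        IsLocalDiffeomorphAt 𝓘(ℝ, (Fin d → ℂ) × (Fin n → ℂ))
          𝓘(ℝ, (Fin n → ℂ) × (Fin d → ℝ) × (Fin d → ℝ)) ∞
          (StationaryJet.oneJetMap A b) ((fun j => (a j : ℂ)), V) := by
  exact fun b hB => ⟨StationaryJet.exists_radius_explicit_lifts hA hB,
    StationaryJet.exists_isLocalDiffeomorphAt_oneJetMap hA hB hli⟩
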